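/- Let $\mathcal{C}$ be a symmetric monoidal category with product $\otimes$ and unit $e$. For $n\ge 0$ let $Y(n)$ be the category whose objects are the complete parenthesizations of nonempty lists of slots in which each of the variables $1,\dots,n$ is inserted into exactly one slot and all other slots are filled with $e$, and which has exactly one morphism from any object to any other. An object $s$ of $Y(n)$ gives a functor $\mathcal{C}^n\to\mathcal{C}$, $\mathbf{x}\mapsto s(\mathbf{x})$ (insert $x_i$ for the variable $i$ and apply $\otimes$), and the unique morphism $s\to t$ acts as a composite $s(\mathbf{x})\to t(\mathbf{x})$ of associativity, unit and symmetry isomorphisms of $\mathcal{C}$. The categories $Y(n)$ form an operad: $\Sigma_n$ acts on the right by renaming variables, so that $(s\cdot\sigma)(x_{\sigma(1)},\dots,x_{\sigma(n)})=s(\mathbf{x})$; the composition $\gamma$ is substitution; the unit $1\in Y(1)$ is the single variable. A choice is a sequence $\kappa$ of arbitrary functions $\kappa_n:\operatorname{Ob}\mathcal{C}^n\to\operatorname{Ob}Y(n)$, $n\ge 0$; write $\overline{\kappa}\mathbf{x}=\kappa_n(\mathbf{x})(\mathbf{x})$. Let $U_\kappa\mathcal{C}$ have the objects of $\mathcal{C}$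 and the morphism sets $U_\kappa\mathcal{C}(\mathbf{x};y)=\mathcal{C}(\overline{\kappa}\mathbf{x},y)$ (taken to be disjoint for different $\mathbf{x}$), with the following structure. - The identity of $a$ is the map $\overline{\kappa}(a)\to a$ given by the unique morphism $\kappa_1(a)\to 1$ in $Y(1)$. - For $\sigma\in\Sigma_n$, the map $\sigma^*:U_\kappa\mathcal{C}(\mathbf{x};y)\to U_\kappa\mathcal{C}(x_{\sigma(1)},\dots,x_{\sigma(n)};y)$ is precomposition with the map given by the unique morphism $\kappa_n(x_{\sigma(1)},\dots,x_{\sigma(n)})\to\kappa_n(\mathbf{x})\cdot\sigma$ in $Y(n)$. - For $f\in U_\kappa\mathcal{C}(\mathbf{y};z)$ and $g_s\in U_\kappa\mathcal{C}(\mathbf{x}_s;y_s)$, $1\le s\le n$, where $\mathbf{x}_s$ has length $j_s$, $j=j_1+\dots+j_n$ and $\mathbf{x}$ is the concatenation of $\mathbf{x}_1,\dots,\mathbf{x}_n$, the composite $\Gamma(f;g_1,\dots,g_n)$ is $$\overline{\kappa}\mathbf{x}\to\gamma(\kappa_n\mathbf{y};\kappa_{j_1}\mathbf{x}_1,\dots,\kappa_{j_n}\mathbf{x}_n)(\mathbf{x})=\kappa_n(\mathbf{y})(\overline{\kappa}\mathbf{x}_1,\dots,\overline{\kappa}\mathbf{x}_n)\xrightarrow{\kappa_n(\mathbf{y})(g_1,\dots,g_n)}\overline{\kappa}\mathbf{y}\xrightarrow{\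 f\ }z,$$ where the first map is given by the unique morphism in $Y(j)$. **Theorem.** The action of the unique morphisms of $Y(n)$ on $\mathcal{C}$ is well defined: for all objects $s,t$ of $Y(n)$ and every $\mathbf{x}\in\operatorname{Ob}\mathcal{C}^n$, any two formal composites of associativity, unit and symmetry isomorphisms from $s$ to $t$ give the same map $s(\mathbf{x})\to t(\mathbf{x})$. For every choice $\kappa$, $U_\kappa\mathcal{C}$ is a multicategory (with symmetric group actions). For any two choices $\kappa$ and $\lambda$ there is a canonical isomorphism of multicategories $\Phi_{\kappa\lambda}:U_\kappa\mathcal{C}\to U_\lambda\mathcal{C}$: it is the identity on objects, and on $U_\kappa\mathcal{C}(\mathbf{x};y)=\mathcal{C}(\overline{\kappa}\mathbf{x},y)\to\mathcal{C}(\overline{\lambda}\mathbf{x},y)=U_\lambda\mathcal{C}(\mathbf{x};y)$ it is precomposition with the map $\overline{\lambda}\mathbf{x}\to\overline{\kappa}\mathbf{x}$ given by the unique isomorphism $\lambda_n\mathbf{x}\to\kappa_n\mathbf{x}$ in $Y(n)$. These isomorphisms are coherent: $\Phi_{\lambda\rho}\circ\Phi_{\kappa\lambda}=\Phi_{\kappa\rho}$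 for any third choice $\rho$, and $\Phi_{\kappa\kappa}$ is the identity of $U_\kappa\mathcal{C}$. -/

import Mathlib

open CategoryTheory MonoidalCategory

universe u v u' v'

namespace SMCMulti

/-! ## Parenthesized words with slots

A `SlotTree I` is a complete parenthesization of a nonempty list of slots; every slot is either
filled with the unit object (`unit`) or with the variable named by some `i : I` (`leaf i`). -/

inductive SlotTree (I : Type) : Type
  | unit : SlotTree I
  | leaf (i : I) : SlotTree I
  | node (a b : SlotTree I) : SlotTree I

namespace SlotTree

variable {I J : Type}

/-- The variables of a parenthesized word, read from left to right. -/
def vars : SlotTree I → List I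
  | unit => []
  | leaf i => [i]
  | node a b => a.vars ++ b.vars

/-- Substitution of parenthesized words for the variables. -/
def bind : SlotTree I → (I → SlotTree J) → SlotTree J
  | unit, _ => unit
  | leaf i, u => u i
  | node a b, u => node (a.bind u) (b.bind u)

/-- Renaming of the variables. -/
def relabel (e : I → J) (t : SlotTree I) : SlotTree J := t.bind fun i => leaf (e i)

theorem vars_bind (t : SlotTree I) (u : I → SlotTree J) :
    (t.bind u).vars = t.vars.flatMap fun i => (u i).vars := by
  induction t with
  | unit => rfl
  | leaf i => simp [bind, vars]
  | node a b ha hb => simp [bind, vars, ha, hb]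

theorem vars_relabel (e : I → J) (t : SlotTree I) : (t.relabel e).vars = t.vars.map e := by
  rw [relabel, vars_bind, List.map_eq_flatMap]
  rfl

/-- Every variable occurs exactly once. -/
def Linear (t : SlotTree I) : Prop := t.vars.Nodup ∧ ∀ i, i ∈ t.vars

section Eval

variable {C : Type u} [Category.{v} C] [MonoidalCategory C]

/-- The object of `C` obtained by inserting the objects `x i` into the slots. -/
def eval : SlotTree I → (I → C) → C
  | unit, _ => 𝟙_ C
  | leaf i, x => x i
  | node a b, x => a.eval x ⊗ b.eval x

/-- Functoriality of `eval` in the inserted objects. -/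
def evalMap : (t : SlotTree I) → {x y : I → C} → (∀ i, x i ⟶ y i) → (t.eval x ⟶ t.eval y)
  | unit, _, _, _ => 𝟙 (𝟙_ C)
  | leaf i, _, _, f => f i
  | node a b, _, _, f => a.evalMap f ⊗ₘ b.evalMap f

theorem eval_bind (t : SlotTree I) (u : I → SlotTree J) (x : J → C) :
    (t.bind u).eval x = t.eval fun i => (u i).eval x := by
  induction t with
  | unit => rfl
  | leaf i => rfl
  | node a b ha hb => simp only [bind, eval, ha, hb]

theorem eval_relabel (e : I → J) (t : SlotTree I) (x : J → C) :
    (t.relabel e).eval x = t.eval (x ∘ e) :=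
  eval_bind _ _ _

end Eval

end SlotTree

open SlotTree

/-! ## Formal coherence isomorphisms -/

/-- Formal composites of instances of the structure isomorphisms of a symmetric monoidal category
(associators, unitors, their inverses, and symmetries), between parenthesized words. -/
inductive Coh {I : Type} : SlotTree I → SlotTree I → Type
  | id (a : SlotTree I) : Coh a a
  | comp {a b c : SlotTree I} (f : Coh a b) (g : Coh b c) : Coh a c
  | tensor {a a' b b' : SlotTree I} (f : Coh a a') (g : Coh b b') : Coh (node a b) (node a' b')
  | assoc (a b c : SlotTree I) : Coh (node (node a b) c) (node a (node b c))
  | assocInv (a b c : SlotTree I) : Coh (node a (node b c)) (node (node a b) c)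
  | leftUnit (a : SlotTree I) : Coh (node unit a) a
  | leftUnitInv (a : SlotTree I) : Coh a (node unit a)
  | rightUnit (a : SlotTree I) : Coh (node a unit) a
  | rightUnitInv (a : SlotTree I) : Coh a (node a unit)
  | swap (a b : SlotTree I) : Coh (node a b) (node b a)

namespace Coh

variable {I : Type}

/-- The morphism of `C` denoted by a formal coherence isomorphism. -/
def eval {C : Type u} [Category.{v} C] [MonoidalCategory C] [SymmetricCategory C] (x : I → C) :
    {s t : SlotTree I} → Coh s t → (s.eval x ⟶ t.eval x)
  | _, _, .id _ => 𝟙 _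
  | _, _, .comp f g => f.eval x ≫ g.eval x
  | _, _, .tensor f g => f.eval x ⊗ₘ g.eval x
  | _, _, .assoc a b c => (α_ (a.eval x) (b.eval x) (c.eval x)).hom
  | _, _, .assocInv a b c => (α_ (a.eval x) (b.eval x) (c.eval x)).inv
  | _, _, .leftUnit a => (λ_ (a.eval x)).hom
  | _, _, .leftUnitInv a => (λ_ (a.eval x)).inv
  | _, _, .rightUnit a => (ρ_ (a.eval x)).hom
  | _, _, .rightUnitInv a => (ρ_ (a.eval x)).inv
  | _, _, .swap a b => (β_ (a.eval x) (b.eval x)).hom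

/-- The formal inverse. -/
def symm : {s t : SlotTree I} → Coh s t → Coh t s
  | _, _, .id a => .id a
  | _, _, .comp f g => .comp g.symm f.symm
  | _, _, .tensor f g => .tensor f.symm g.symm
  | _, _, .assoc a b c => .assocInv a b c
  | _, _, .assocInv a b c => .assoc a b c
  | _, _, .leftUnit a => .leftUnitInv a
  | _, _, .leftUnitInv a => .leftUnit a
  | _, _, .rightUnit a => .rightUnitInv a
  | _, _, .rightUnitInv a => .rightUnit a
  | _, _, .swap a b => .swap b a

/-- The right-parenthesized word on a list of variables. -/
def ofList : List I → SlotTree I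
  | [] => unit
  | i :: l => node (leaf i) (ofList l)

def append : (l m : List I) → Coh (node (ofList l) (ofList m)) (ofList (l ++ m))
  | [], m => .leftUnit (ofList m)
  | i :: l, m => .comp (.assoc (leaf i) (ofList l) (ofList m)) (.tensor (.id _) (append l m))

def normalize : (t : SlotTree I) → Coh t (ofList t.vars)
  | unit => .id _
  | leaf i => .rightUnitInv (leaf i)
  | node a b => .comp (.tensor (normalize a) (normalize b)) (append a.vars b.vars)

theorem nonempty_of_perm {l m : List I} (h : l.Perm m) : Nonempty (Coh (ofList l) (ofList m)) := by
  induction h with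
  | nil => exact ⟨.id _⟩
  | cons i _ ih => exact ih.map fun f => .tensor (.id _) f
  | swap i k l =>
    exact ⟨.comp (.assocInv _ _ _) (.comp (.tensor (.swap _ _) (.id _)) (.assoc _ _ _))⟩
  | trans _ _ ih₁ ih₂ => exact ih₁.elim fun f => ih₂.map fun g => .comp f g

theorem nonempty_of_linear {s t : SlotTree I} (hs : s.Linear) (ht : t.Linear) :
    Nonempty (Coh s t) :=
  (nonempty_of_perm ((List.perm_ext_iff_of_nodup hs.1 ht.1).2 fun i =>
    ⟨fun _ => ht.2 i, fun _ => hs.2 i⟩)).map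
      fun f => .comp (normalize s) (.comp f (normalize t).symm)

end Coh

/-! ## The operad `Y` -/

/-- Objects of `Y(n)`: parenthesized words in which each of `n` variables is inserted into exactly
one slot, all other slots being filled with the unit. -/
structure Y (n : ℕ) where
  tree : SlotTree (Fin n)
  linear : tree.Linear

/-- `Y(n)` has exactly one morphism from any object to any other. -/
instance (n : ℕ) : Category (Y n) where
  Hom _ _ := Unit
  id _ := ()
  comp _ _ := ()

instance {n : ℕ} (s t : Y n) : Unique (s ⟶ t) := inferInstanceAs (Unique Unit)

/-- The concatenation of a family of tuples. -/
def concat {α : Type u} {n : ℕ} {j : Fin n → ℕ} (x : ∀ s, Fin (j s) → α) : Fin (∑ s, j s) → α :=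
  fun p => x (finSigmaFinEquiv.symm p).1 (finSigmaFinEquiv.symm p).2

namespace Y

/-- The operad unit. -/
def one : Y 1 where
  tree := leaf 0
  linear := ⟨List.nodup_singleton _, fun i => by simp [vars, Subsingleton.elim i 0]⟩

/-- The right action of `Σ_n` on the objects of `Y(n)`. -/
def perm {n : ℕ} (s : Y n) (σ : Equiv.Perm (Fin n)) : Y n where
  tree := s.tree.relabel σ.symm
  linear := by
    refine ⟨?_, fun i => ?_⟩
    · rw [vars_relabel]
      exact s.linear.1.map σ.symm.injective
    · rw [vars_relabel, List.mem_map]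
      exact ⟨σ i, s.linear.2 _, σ.symm_apply_apply i⟩

/-- The operad composition on objects: the `k`-th variable of `t s` becomes the `k`-th
variable of the `s`-th block. -/
def gamma {n : ℕ} {j : Fin n → ℕ} (r : Y n) (t : ∀ s, Y (j s)) : Y (∑ s, j s) where
  tree := r.tree.bind fun s => (t s).tree.relabel fun k => finSigmaFinEquiv ⟨s, k⟩
  linear := by
    refine ⟨?_, fun i => ?_⟩
    · rw [vars_bind, List.nodup_flatMap]
      refine ⟨fun s _ => ?_, r.linear.1.imp fun {a b} hab => ?_⟩
      · rw [vars_relabel]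
        refine (t s).linear.1.map fun k l h => ?_
        simpa using h
      · intro p hp hq
        simp only [vars_relabel, List.mem_map] at hp hq
        obtain ⟨k, _, rfl⟩ := hp
        obtain ⟨l, _, hl⟩ := hq
        exact hab (congrArg Sigma.fst (finSigmaFinEquiv.injective hl)).symm
    · rw [vars_bind, List.mem_flatMap]
      refine ⟨(finSigmaFinEquiv.symm i).1, r.linear.2 _, ?_⟩
      rw [vars_relabel, List.mem_map]
      exact ⟨(finSigmaFinEquiv.symm i).2, (t _).linear.2 _, finSigmaFinEquiv.apply_symm_apply i⟩

section Action

variable {C : Type u} [Category.{v} C] [MonoidalCategory C]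

/-- The object `s(x)` of `C`. -/
def obj {n : ℕ} (s : Y n) (x : Fin n → C) : C := s.tree.eval x

/-- The functor `C^n → C` given by `s`, on morphisms. -/
def map {n : ℕ} (s : Y n) {x y : Fin n → C} (f : ∀ i, x i ⟶ y i) : s.obj x ⟶ s.obj y :=
  s.tree.evalMap f

/-- The morphism `s(x) ⟶ t(x)` by which the unique morphism `s ⟶ t` of `Y(n)` acts on a symmetric
monoidal category: any composite of associativity, unit and symmetry isomorphisms that connects
the two words. (By Mac Lane's coherence theorem all such composites are equal, because every
variable occurs exactly once in each of the two words.) -/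
noncomputable def act [SymmetricCategory C] {n : ℕ} {s t : Y n} (_ : s ⟶ t) (x : Fin n → C) :
    s.obj x ⟶ t.obj x :=
  (Classical.choice (Coh.nonempty_of_linear s.linear t.linear)).eval x

theorem obj_perm {n : ℕ} (s : Y n) (σ : Equiv.Perm (Fin n)) (x : Fin n → C) :
    (s.perm σ).obj (x ∘ σ) = s.obj x :=
  (eval_relabel _ _ _).trans (congrArg s.tree.eval (funext fun i => congrArg x (by simp)))

theorem obj_gamma {n : ℕ} {j : Fin n → ℕ} (r : Y n) (t : ∀ s, Y (j s))
    (x : ∀ s, Fin (j s) → C) :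
    (r.gamma t).obj (concat x) = r.obj fun s => (t s).obj (x s) := by
  refine (eval_bind _ _ _).trans (congrArg r.tree.eval (funext fun s => ?_))
  refine (eval_relabel _ _ _).trans (congrArg (t s).tree.eval (funext fun k => ?_))
  show x _ _ = x s k
  rw [Equiv.symm_apply_apply]

end Action

end Y

/-! ## Multicategories -/

/-- The data of a (symmetric) multicategory. A multimorphism carries its source tuple and its
target in its type, so morphism sets for different sources are disjoint. -/
structure MulticategoryData where
  Obj : Type u
  Hom : {n : ℕ} → (Fin n → Obj) → Obj → Type v
  id : (a : Obj) → Hom (fun _ : Fin 1 => a) a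
  /-- The composition multiproduct. -/
  comp : {n : ℕ} → {j : Fin n → ℕ} → {y : Fin n → Obj} → {z : Obj} →
    {x : ∀ s, Fin (j s) → Obj} → Hom y z → (∀ s, Hom (x s) (y s)) → Hom (concat x) z
  /-- The right action of the symmetric groups. -/
  perm : {n : ℕ} → {x : Fin n → Obj} → {y : Obj} → (σ : Equiv.Perm (Fin n)) → Hom x y →
    Hom (x ∘ σ) y

namespace MulticategoryData

/-- The set of all multimorphisms with target `y`, of arbitrary source. -/
def Arrow (M : MulticategoryData.{u, v}) (y : M.Obj) : Type (max u v) :=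
  Σ (n : ℕ) (x : Fin n → M.Obj), M.Hom x y

/-- A multimorphism, together with its source tuple. -/
def arrow (M : MulticategoryData.{u, v}) {n : ℕ} {x : Fin n → M.Obj} {y : M.Obj}
    (f : M.Hom x y) : M.Arrow y := ⟨n, x, f⟩

/-- The block permutation `σ⟨j_{σ(1)}, …, j_{σ(n)}⟩`: in terms of blocks, it sends the `k`-th entry
of the `s`-th block of a tuple with block lengths `j_{σ(1)}, …, j_{σ(n)}` to the `k`-th entry of
the `σ(s)`-th block of a tuple with block lengths `j_1, …, j_n`. -/
def blockPerm {n : ℕ} (j : Fin n → ℕ) (σ : Equiv.Perm (Fin n)) : Equiv.Perm (Fin (∑ s, j s)) :=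
  (finCongr (Equiv.sum_comp σ j).symm).trans
    (finSigmaFinEquiv.symm.trans
      ((Equiv.sigmaCongrLeft (β := fun s => Fin (j s)) σ).trans finSigmaFinEquiv))

/-- The block sum `τ_1 ⊕ ⋯ ⊕ τ_n`. -/
def sumPerm {n : ℕ} {j : Fin n → ℕ} (τ : ∀ s, Equiv.Perm (Fin (j s))) :
    Equiv.Perm (Fin (∑ s, j s)) :=
  finSigmaFinEquiv.symm.trans ((Equiv.sigmaCongrRight τ).trans finSigmaFinEquiv)

/-- The axioms of a multicategory. Where the source tuples of the two sides are equal without being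
syntactically so, the equation is one between multimorphisms together with their sources. -/
structure IsMulticategory (M : MulticategoryData.{u, v}) : Prop where
  perm_one : ∀ {n : ℕ} {x : Fin n → M.Obj} {y : M.Obj} (f : M.Hom x y), M.perm 1 f = f
  perm_mul : ∀ {n : ℕ} {x : Fin n → M.Obj} {y : M.Obj} (σ τ : Equiv.Perm (Fin n))
    (f : M.Hom x y), M.perm τ (M.perm σ f) = M.perm (σ * τ) f
  assoc : ∀ {n : ℕ} {j : Fin n → ℕ} {k : ∀ s, Fin (j s) → ℕ} {d : M.Obj} {c : Fin n → M.Obj}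
    {b : ∀ s, Fin (j s) → M.Obj} {a : ∀ s t, Fin (k s t) → M.Obj}
    (f : M.Hom c d) (g : ∀ s, M.Hom (b s) (c s)) (h : ∀ s t, M.Hom (a s t) (b s t)),
    M.arrow (M.comp (M.comp f g)
        fun p => h (finSigmaFinEquiv.symm p).1 (finSigmaFinEquiv.symm p).2) =
      M.arrow (M.comp f fun s => M.comp (g s) (h s))
  comp_id : ∀ {n : ℕ} {x : Fin n → M.Obj} {y : M.Obj} (f : M.Hom x y),
    M.arrow (M.comp f fun s => M.id (x s)) = M.arrow f
  id_comp : ∀ {n : ℕ} {x : Fin n → M.Obj} {y : M.Obj} (f : M.Hom x y),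
    M.arrow (M.comp (M.id y) fun _ => f) = M.arrow f
  perm_comp : ∀ {n : ℕ} {j : Fin n → ℕ} {d : M.Obj} {c : Fin n → M.Obj}
    {b : ∀ s, Fin (j s) → M.Obj} (σ : Equiv.Perm (Fin n))
    (f : M.Hom c d) (g : ∀ s, M.Hom (b s) (c s)),
    M.arrow (M.comp (M.perm σ f) fun s => g (σ s)) =
      M.arrow (M.perm (blockPerm j σ) (M.comp f g))
  comp_perm : ∀ {n : ℕ} {j : Fin n → ℕ} {d : M.Obj} {c : Fin n → M.Obj}
    {b : ∀ s, Fin (j s) → M.Obj} (τ : ∀ s, Equiv.Perm (Fin (j s)))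
    (f : M.Hom c d) (g : ∀ s, M.Hom (b s) (c s)),
    M.arrow (M.comp f fun s => M.perm (τ s) (g s)) =
      M.arrow (M.perm (sumPerm τ) (M.comp f g))

end MulticategoryData

/-- Maps on objects and on multimorphisms, compatible with sources and targets. -/
@[ext]
structure MultigraphMap (M : MulticategoryData.{u, v}) (N : MulticategoryData.{u', v'}) where
  obj : M.Obj → N.Obj
  map : {n : ℕ} → {x : Fin n → M.Obj} → {y : M.Obj} → M.Hom x y → N.Hom (obj ∘ x) (obj y)

/-- Maps of multicategories: they preserve identities, composition and symmetric group actions. -/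
@[ext]
structure Multifunctor (M : MulticategoryData.{u, v}) (N : MulticategoryData.{u', v'})
    extends MultigraphMap M N where
  map_id : ∀ a : M.Obj, map (M.id a) = N.id (obj a)
  map_comp : ∀ {n : ℕ} {j : Fin n → ℕ} {y : Fin n → M.Obj} {z : M.Obj}
    {x : ∀ s, Fin (j s) → M.Obj} (f : M.Hom y z) (g : ∀ s, M.Hom (x s) (y s)),
    map (M.comp f g) = N.comp (map f) fun s => map (g s)
  map_perm : ∀ {n : ℕ} {x : Fin n → M.Obj} {y : M.Obj} (σ : Equiv.Perm (Fin n)) (f : M.Hom x y),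
    map (M.perm σ f) = N.perm σ (map f)

namespace Multifunctor

/-- The identity map of a multicategory. -/
def id (M : MulticategoryData.{u, v}) : Multifunctor M M where
  obj a := a
  map f := f
  map_id _ := rfl
  map_comp _ _ := rfl
  map_perm _ _ := rfl

/-- The composite `M → N → P`. -/
def comp {M N P : MulticategoryData.{u, v}} (F : Multifunctor M N) (G : Multifunctor N P) :
    Multifunctor M P where
  obj a := G.obj (F.obj a)
  map f := G.map (F.map f)
  map_id a := by rw [F.map_id]; exact G.map_id _
  map_comp f g := by rw [F.map_comp]; exact G.map_comp _ _
  map_perm σ f := by rw [F.map_perm]; exact G.map_perm _ _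

end Multifunctor

/-- Isomorphisms of multicategories. -/
structure MultiIso (M N : MulticategoryData.{u, v}) where
  hom : Multifunctor M N
  inv : Multifunctor N M
  hom_inv_id : hom.comp inv = Multifunctor.id M
  inv_hom_id : inv.comp hom = Multifunctor.id N

/-! ## Underlying multicategories of a symmetric monoidal category -/

/-- A sequence of functions `κ_n : Ob C^n → Ob Y(n)`. -/
abbrev Choice (C : Type u) : Type u := ∀ n : ℕ, (Fin n → C) → Y n

section Underlying

variable {C : Type u} [Category.{v} C] [MonoidalCategory C]

/-- `κ̄x = κ_n(x)(x)`. -/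
def Choice.bar (κ : Choice C) {n : ℕ} (x : Fin n → C) : C := (κ n x).obj x

variable [SymmetricCategory C]

/-- The underlying multicategory `U_κ C`, with `U_κ C(x; y) = C(κ̄x, y)`. -/
noncomputable def U (κ : Choice C) : MulticategoryData.{u, v} where
  Obj := C
  Hom x y := κ.bar x ⟶ y
  id a := Y.act (default : κ 1 (fun _ => a) ⟶ Y.one) (fun _ => a)
  comp {n j y _ x} f g :=
    Y.act (default : κ _ (concat x) ⟶ (κ n y).gamma fun s => κ (j s) (x s)) (concat x) ≫
      eqToHom ((κ n y).obj_gamma _ x) ≫ (κ n y).map g ≫ f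
  perm {n x _} σ f :=
    Y.act (default : κ n (x ∘ σ) ⟶ (κ n x).perm σ) (x ∘ σ) ≫
      eqToHom ((κ n x).obj_perm σ x) ≫ f

/-- The map `U_κ C → U_μ C` that is the identity on objects and, on multimorphisms with source `x`,
precomposition with the morphism `μ̄x ⟶ κ̄x` given by the unique morphism `μ_n x ⟶ κ_n x` in
`Y(n)`. -/
noncomputable def canonicalMap (κ μ : Choice C) : MultigraphMap (U κ) (U μ) where
  obj (a : C) := a
  map := fun {n} {x : Fin n → C} {y : C} (f : κ.bar x ⟶ y) =>
    (Y.act (default : μ n x ⟶ κ n x) x ≫ f : μ.bar x ⟶ y)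

end Underlying

end SMCMulti

open SMCMulti

/-! The core is Mac Lane coherence for words in which no variable is repeated. Fix a list containing
each variable once. A word can be multiplied out into a product over this list that has `x i` at the
places of its variables and units elsewhere; this is an isomorphism (`toSparse`). The multiplication
behaves like a partially defined commutative monoid: since no variable is repeated, `x i` is never
multiplied with itself, so associativity, unit and commutativity hold on each factor by properties
of unitors and of braidings with the unit. The middle-four interchange `tensorμ` carries these laws
over to products. Hence multiplying out commutes with every associator, unitor and symmetry
(`eval_toSparse`), and any formal composite from `s` to `t` equals multiplying out `s` followed by
the inverse of multiplying out `t`, which does not mention the composite (`coh_eval_unique`).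

The rest rests on this uniqueness. The structure maps of `U κ` are morphisms of the action combined
with identifications of objects such as `obj_gamma`. `IsCan` records that such a map comes from a
formal composite between two given words; the property passes to composites and to values of the
functors given by words, and two parallel maps with it agree when the source word repeats no
variable (`IsCan.unique`). Each axiom then follows one pattern: naturality moves the given
multimorphisms to the end of both sides, and what remains in front are two canonical maps between
the same words. When the two source tuples are not syntactically equal, `arrow_eq` also compares
their orders. Compatibility of the change-of-choice maps with composition and permutations is proved
in the same way; their coherence is the composition law `Y.act_comp`. -/

namespace SMCMulti

open SlotTree

/-! ## Coherence for words without repeated variables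

For `x : I → C`, a list `l` of variables and `S : I → Bool`, the object `sparse x l S` is the
right-parenthesized product over `l` of the objects `x i` with `S i = true`, with units at the other
places. Factorwise multiplication turns words without repeated variables into such products,
compatibly with the structure isomorphisms. -/

section Coherence

variable {C : Type u} [Category.{v} C] [MonoidalCategory C]

/-- The object `X` or the unit. -/
def factor (X : C) : Bool → C
  | false => 𝟙_ C
  | true => X

/-- Multiplication of factors, at most one of which is not the unit. -/
def factorMul (X : C) : (p q r : Bool) → p.toNat + q.toNat = r.toNat →
    (factor X p ⊗ factor X q ⟶ factor X r)
  | false, false, false, _ => (λ_ (𝟙_ C)).hom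
  | false, true, true, _ => (λ_ X).hom
  | true, false, true, _ => (ρ_ X).hom
  | false, false, true, h => absurd h (by decide)
  | false, true, false, h => absurd h (by decide)
  | true, false, false, h => absurd h (by decide)
  | true, true, false, h => absurd h (by decide)
  | true, true, true, h => absurd h (by decide)

instance isIso_factorMul (X : C) (p q r : Bool) (h : p.toNat + q.toNat = r.toNat) :
    IsIso (factorMul X p q r h) := by
  cases p <;> cases q <;> cases r <;> first
    | exact absurd h (by decide)
    | (dsimp only [factorMul, factor]; infer_instance)

/-- The hypotheses leave at most one `X` among the three factors, so only unitors and associators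
occur and plain monoidal coherence decides each case. -/
theorem factorMul_assoc (X : C) {p q r pq qr s : Bool} (h₁ : p.toNat + q.toNat = pq.toNat)
    (h₂ : pq.toNat + r.toNat = s.toNat) (h₃ : q.toNat + r.toNat = qr.toNat)
    (h₄ : p.toNat + qr.toNat = s.toNat) :
    factorMul X p q pq h₁ ▷ factor X r ≫ factorMul X pq r s h₂ =
      (α_ _ _ _).hom ≫ factor X p ◁ factorMul X q r qr h₃ ≫ factorMul X p qr s h₄ := by
  cases p <;> cases q <;> cases r <;> cases pq <;> cases qr <;> cases s <;> first
    | exact absurd h₁ (by decide)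
    | exact absurd h₂ (by decide)
    | exact absurd h₃ (by decide)
    | exact absurd h₄ (by decide)
    | (dsimp only [factorMul, factor]; monoidal)

/-- The unit as a factor. -/
def factorOne (X : C) : (p : Bool) → p = false → (𝟙_ C ⟶ factor X p)
  | false, _ => 𝟙 _
  | true, h => absurd h (by decide)

instance isIso_factorOne (X : C) (p : Bool) (h : p = false) : IsIso (factorOne X p h) := by
  subst h
  dsimp only [factorOne, factor]
  infer_instance

theorem factorOne_mul (X : C) {p q : Bool} (hp : p = false) (h : p.toNat + q.toNat = q.toNat) :
    factorOne X p hp ▷ factor X q ≫ factorMul X p q q h = (λ_ _).hom := by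
  subst hp
  cases q <;> simp [factorOne, factorMul, factor]

theorem mul_factorOne (X : C) {p q : Bool} (hq : q = false) (h : p.toNat + q.toNat = p.toNat) :
    factor X p ◁ factorOne X q hq ≫ factorMul X p q p h = (ρ_ _).hom := by
  subst hq
  cases p <;> simp [factorOne, factorMul, factor, unitors_equal]

/-- The product over `l` of the objects `x i` with `S i`, with units at the other places. -/
def sparse {I : Type} (x : I → C) : List I → (I → Bool) → C
  | [], _ => 𝟙_ C
  | i :: l, S => factor (x i) (S i) ⊗ sparse x l S

/-- The product of units. -/
def sparseOne {I : Type} (x : I → C) : (l : List I) → (S : I → Bool) → (∀ i, S i = false) →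
    (𝟙_ C ⟶ sparse x l S)
  | [], _, _ => 𝟙 _
  | i :: l, S, h => (λ_ (𝟙_ C)).inv ≫ (factorOne (x i) (S i) (h i) ⊗ₘ sparseOne x l S h)

instance isIso_sparseOne {I : Type} (x : I → C) (l : List I) (S : I → Bool)
    (h : ∀ i, S i = false) : IsIso (sparseOne x l S h) := by
  induction l with
  | nil => dsimp only [sparseOne, sparse]; infer_instance
  | cons i l ih => dsimp only [sparseOne, sparse]; infer_instance

theorem sparse_congr {I : Type} (x : I → C) {l : List I} {S T : I → Bool}
    (h : ∀ i ∈ l, S i = T i) : sparse x l S = sparse x l T := by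
  induction l with
  | nil => rfl
  | cons i l ih =>
    rw [sparse, sparse, h i (by simp), ih fun k hk => h k (by simp [hk])]

/-- If `S` is supported at a single member of `l`, only one factor is left. -/
theorem nonempty_iso_sparse {I : Type} [DecidableEq I] (x : I → C) {l : List I} (hl : l.Nodup)
    {i : I} (hi : i ∈ l) {S : I → Bool} (hS : ∀ k, S k = decide (k = i)) :
    Nonempty (x i ≅ sparse x l S) := by
  induction l with
  | nil => simp at hi
  | cons k l ih =>
    rw [List.nodup_cons] at hl
    by_cases hk : k = i
    · subst hk
      have e : 𝟙_ C ≅ sparse x l S :=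
        asIso (sparseOne x l (fun _ => false) fun _ => rfl) ≪≫
          eqToIso (sparse_congr x fun m hm => by
            rw [hS, eq_comm, decide_eq_false_iff_not]
            rintro rfl
            exact hl.1 hm)
      have e' : x k ≅ factor (x k) (S k) := eqToIso (by simp [hS, factor])
      exact ⟨(ρ_ _).symm ≪≫ (e' ⊗ᵢ e)⟩
    · obtain ⟨e⟩ := ih hl.2 ((List.mem_cons.1 hi).resolve_left (Ne.symm hk))
      have e' : 𝟙_ C ≅ factor (x k) (S k) := eqToIso (by simp [hS, hk, factor])
      exact ⟨(λ_ _).symm ≪≫ (e' ⊗ᵢ e)⟩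

/-! ### Factorwise multiplication of sparse products -/

variable [SymmetricCategory C]

/-- One of the two factors is always the unit, and braiding with the unit is a composite of unitors;
the self-braiding of `X` never appears. -/
theorem factorMul_comm (X : C) {p q r : Bool} (h : p.toNat + q.toNat = r.toNat)
    (h' : q.toNat + p.toNat = r.toNat) :
    (β_ _ _).hom ≫ factorMul X q p r h' = factorMul X p q r h := by
  cases p <;> cases q <;> cases r <;> first
    | exact absurd h (by decide)
    | simp [factorMul, factor, unitors_equal, unitors_inv_equal]

instance isIso_tensorμ (X₁ X₂ Y₁ Y₂ : C) : IsIso (tensorμ X₁ X₂ Y₁ Y₂) :=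
  ⟨tensorδ X₁ X₂ Y₁ Y₂, by simp, by simp⟩

theorem braiding_tensorμ (X₁ X₂ Y₁ Y₂ : C) :
    (β_ (X₁ ⊗ X₂) (Y₁ ⊗ Y₂)).hom ≫ tensorμ Y₁ Y₂ X₁ X₂ =
      tensorμ X₁ X₂ Y₁ Y₂ ≫ ((β_ X₁ Y₁).hom ⊗ₘ (β_ X₂ Y₂).hom) := by
  dsimp only [tensorμ]
  simp only [Category.assoc, BraidedCategory.braiding_tensor_right_hom,
    BraidedCategory.braiding_tensor_left_hom,
    comp_whiskerRight, whisker_assoc, whiskerLeft_comp, pentagon_assoc,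
    pentagon_inv_hom_hom_hom_inv_assoc, Iso.inv_hom_id_assoc, whiskerLeft_hom_inv_assoc]
  -- The large braiding crosses `X₁` over `Y₂` and `tensorμ` crosses them back. Cancelling the two
  -- requires a symmetry, not just a braiding.
  have h : Y₁ ◁ (β_ X₁ Y₂).hom ▷ X₂ ≫ Y₁ ◁ (β_ Y₂ X₁).hom ▷ X₂ = 𝟙 _ := by
    rw [← whiskerLeft_comp, ← comp_whiskerRight, SymmetricCategory.symmetry, id_whiskerRight,
      whiskerLeft_id]
  rw [reassoc_of% h, MonoidalCategory.tensorHom_def]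
  monoidal

/-- Factorwise multiplication. -/
def sparseMul {I : Type} (x : I → C) : (l : List I) → (S T U : I → Bool) →
    (∀ i, (S i).toNat + (T i).toNat = (U i).toNat) → (sparse x l S ⊗ sparse x l T ⟶ sparse x l U)
  | [], _, _, _, _ => (λ_ (𝟙_ C)).hom
  | i :: l, S, T, U, h => tensorμ _ _ _ _ ≫
      (factorMul (x i) (S i) (T i) (U i) (h i) ⊗ₘ sparseMul x l S T U h)

variable {I : Type} (x : I → C) (l : List I)

instance isIso_sparseMul (S T U : I → Bool) (h : ∀ i, (S i).toNat + (T i).toNat = (U i).toNat) :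
    IsIso (sparseMul x l S T U h) := by
  induction l with
  | nil => dsimp only [sparseMul, sparse]; infer_instance
  | cons i l ih => dsimp only [sparseMul, sparse]; infer_instance

theorem sparseMul_comm {S T U : I → Bool} (h : ∀ i, (S i).toNat + (T i).toNat = (U i).toNat)
    (h' : ∀ i, (T i).toNat + (S i).toNat = (U i).toNat) :
    (β_ _ _).hom ≫ sparseMul x l T S U h' = sparseMul x l S T U h := by
  induction l with
  | nil => simp [sparseMul, sparse, unitors_equal, unitors_inv_equal]
  | cons i l ih =>
    dsimp only [sparseMul, sparse]
    rw [← Category.assoc, braiding_tensorμ, Category.assoc, tensorHom_comp_tensorHom, ih,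
      factorMul_comm]

theorem sparseMul_assoc {S T V ST TV U : I → Bool}
    (h₁ : ∀ i, (S i).toNat + (T i).toNat = (ST i).toNat)
    (h₂ : ∀ i, (ST i).toNat + (V i).toNat = (U i).toNat)
    (h₃ : ∀ i, (T i).toNat + (V i).toNat = (TV i).toNat)
    (h₄ : ∀ i, (S i).toNat + (TV i).toNat = (U i).toNat) :
    sparseMul x l S T ST h₁ ▷ sparse x l V ≫ sparseMul x l ST V U h₂ =
      (α_ _ _ _).hom ≫ sparse x l S ◁ sparseMul x l T V TV h₃ ≫ sparseMul x l S TV U h₄ := by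
  induction l with
  | nil => dsimp only [sparseMul, sparse]; monoidal
  | cons i l ih =>
    dsimp only [sparseMul, sparse]
    simp only [comp_whiskerRight, whiskerLeft_comp, Category.assoc]
    rw [tensorμ_natural_left_assoc, tensorμ_natural_right_assoc, tensorHom_comp_tensorHom,
      tensorHom_comp_tensorHom, ih, factorMul_assoc (x i) (h₁ i) (h₂ i) (h₃ i) (h₄ i),
      ← tensorHom_comp_tensorHom, tensor_associativity_assoc]

/-- Associativity in the form in which it applies to a triple product of multiplied-out words. -/
theorem tensorHom_sparseMul_assoc {S T V ST TV U : I → Bool}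
    (h₁ : ∀ i, (S i).toNat + (T i).toNat = (ST i).toNat)
    (h₂ : ∀ i, (ST i).toNat + (V i).toNat = (U i).toNat)
    (h₃ : ∀ i, (T i).toNat + (V i).toNat = (TV i).toNat)
    (h₄ : ∀ i, (S i).toNat + (TV i).toNat = (U i).toNat) {a b c : C} (f : a ⟶ sparse x l S)
    (g : b ⟶ sparse x l T) (k : c ⟶ sparse x l V) :
    (α_ _ _ _).hom ≫ (f ⊗ₘ ((g ⊗ₘ k) ≫ sparseMul x l T V TV h₃)) ≫ sparseMul x l S TV U h₄ =
      (((f ⊗ₘ g) ≫ sparseMul x l S T ST h₁) ⊗ₘ k) ≫ sparseMul x l ST V U h₂ := by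
  have e₁ : f ⊗ₘ ((g ⊗ₘ k) ≫ sparseMul x l T V TV h₃) =
      (f ⊗ₘ g ⊗ₘ k) ≫ _ ◁ sparseMul x l T V TV h₃ := by
    rw [← id_tensorHom, tensorHom_comp_tensorHom, Category.comp_id]
  have e₂ : ((f ⊗ₘ g) ≫ sparseMul x l S T ST h₁) ⊗ₘ k =
      ((f ⊗ₘ g) ⊗ₘ k) ≫ sparseMul x l S T ST h₁ ▷ _ := by
    rw [← tensorHom_id, tensorHom_comp_tensorHom, Category.comp_id]
  rw [e₁, e₂, Category.assoc, Category.assoc, sparseMul_assoc x l h₁ h₂ h₃ h₄,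
    associator_naturality_assoc]

theorem sparseOne_mul {S T : I → Bool} (hS : ∀ i, S i = false)
    (h : ∀ i, (S i).toNat + (T i).toNat = (T i).toNat) :
    sparseOne x l S hS ▷ sparse x l T ≫ sparseMul x l S T T h = (λ_ _).hom := by
  induction l with
  | nil => simp [sparseOne, sparseMul, sparse]
  | cons i l ih =>
    dsimp only [sparseMul, sparse, sparseOne]
    rw [comp_whiskerRight, Category.assoc, tensorμ_natural_left_assoc, tensorHom_comp_tensorHom,
      ih, factorOne_mul, ← tensor_left_unitality]

theorem mul_sparseOne {S T : I → Bool} (hT : ∀ i, T i = false)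
    (h : ∀ i, (S i).toNat + (T i).toNat = (S i).toNat) :
    sparse x l S ◁ sparseOne x l T hT ≫ sparseMul x l S T S h = (ρ_ _).hom := by
  induction l with
  | nil => simp [sparseOne, sparseMul, sparse, unitors_equal]
  | cons i l ih =>
    dsimp only [sparseMul, sparse, sparseOne]
    rw [whiskerLeft_comp, Category.assoc, tensorμ_natural_right_assoc, tensorHom_comp_tensorHom,
      ih, mul_factorOne, ← tensor_right_unitality]

/-! ### Multiplying out words and coherence -/

theorem vars_perm_of_coh {I : Type} {s t : SlotTree I} (m : Coh s t) : s.vars.Perm t.vars := by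
  induction m with
  | id a => exact .refl _
  | comp f g ihf ihg => exact ihf.trans ihg
  | tensor f g ihf ihg => exact ihf.append ihg
  | assoc a b c => simp [vars]
  | assocInv a b c => simp [vars]
  | leftUnit a => simp [vars]
  | leftUnitInv a => simp [vars]
  | rightUnit a => simp [vars]
  | rightUnitInv a => simp [vars]
  | swap a b => exact List.perm_append_comm

variable [DecidableEq I]

/-- The indicator function of the variables of a word. -/
def occurs (t : SlotTree I) (i : I) : Bool := decide (i ∈ t.vars)

theorem toNat_occurs {t : SlotTree I} {i : I} (h : t.vars.count i ≤ 1) :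
    (occurs t i).toNat = t.vars.count i := by
  by_cases hi : i ∈ t.vars
  · have := List.count_pos_iff.2 hi
    simp only [occurs, hi, decide_true, Bool.toNat_true]
    omega
  · simp [occurs, hi, List.count_eq_zero_of_not_mem hi]

/-- `S` counts the occurrences of the variables in `t`. In particular no variable is repeated. -/
def Counts (t : SlotTree I) (S : I → Bool) : Prop := ∀ i, (S i).toNat = t.vars.count i

variable {l}

/-- Lets indicator functions be exchanged freely: the word determines them. -/
theorem Counts.unique {t : SlotTree I} {S T : I → Bool} (hS : Counts t S) (hT : Counts t T) :
    S = T :=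
  funext fun i => by
    have := (hS i).trans (hT i).symm
    cases hs : S i <;> cases ht : T i <;> simp_all

theorem Counts.add {a b : SlotTree I} {S T U : I → Bool} (hS : Counts a S) (hT : Counts b T)
    (h : Counts (node a b) U) (i : I) : (S i).toNat + (T i).toNat = (U i).toNat := by
  rw [hS, hT, h, vars, List.count_append]

theorem Counts.left {a b : SlotTree I} {S : I → Bool} (h : Counts (node a b) S) :
    Counts a (occurs a) := fun i => toNat_occurs <| by
  have := h i
  have := (S i).toNat_le
  rw [vars, List.count_append] at *
  omega

theorem Counts.right {a b : SlotTree I} {S : I → Bool} (h : Counts (node a b) S) :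
    Counts b (occurs b) := fun i => toNat_occurs <| by
  have := h i
  have := (S i).toNat_le
  rw [vars, List.count_append] at *
  omega

theorem Counts.eq_false {S : I → Bool} (h : Counts unit S) (i : I) : S i = false := by
  simpa [vars] using h i

theorem Counts.eq_decide {i : I} {S : I → Bool} (h : Counts (leaf i) S) (k : I) :
    S k = decide (k = i) := by
  have := h k
  by_cases hk : k = i
  · simpa [vars, hk] using this
  · simpa [vars, hk, Ne.symm hk] using this

/-- Multiplying out a word without repeated variables. -/
noncomputable def toSparse (hl : l.Nodup) (hl' : ∀ i, i ∈ l) : (t : SlotTree I) →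
    (S : I → Bool) → Counts t S → (t.eval x ⟶ sparse x l S)
  | unit, S, h => sparseOne x l S h.eq_false
  -- Any isomorphism will do: no structure isomorphism looks inside a leaf, so it only matters that
  -- the same choice serves every word.
  | leaf i, _, h => (Classical.choice (nonempty_iso_sparse x hl (hl' i) h.eq_decide)).hom
  | node a b, S, h =>
      (toSparse hl hl' a (occurs a) h.left ⊗ₘ toSparse hl hl' b (occurs b) h.right) ≫
        sparseMul x l (occurs a) (occurs b) S (h.left.add h.right h)

instance isIso_toSparse (hl : l.Nodup) (hl' : ∀ i, i ∈ l) (t : SlotTree I) (S : I → Bool)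
    (h : Counts t S) : IsIso (toSparse x hl hl' t S h) := by
  induction t generalizing S with
  | unit => dsimp only [toSparse, SlotTree.eval]; infer_instance
  | leaf i => dsimp only [toSparse, SlotTree.eval]; infer_instance
  | node a b iha ihb =>
    have := iha _ h.left
    have := ihb _ h.right
    dsimp only [toSparse, SlotTree.eval]
    infer_instance

/-- Frees the recursion from the particular functions `occurs a` and `occurs b`, so that both sides
of a coherence square can be expanded with the same indicators. -/
theorem toSparse_node (hl : l.Nodup) (hl' : ∀ i, i ∈ l) {a b : SlotTree I} {S T U : I → Bool}
    (hS : Counts a S) (hT : Counts b T) (hU : Counts (node a b) U) :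
    toSparse x hl hl' (node a b) U hU =
      (toSparse x hl hl' a S hS ⊗ₘ toSparse x hl hl' b T hT) ≫
        sparseMul x l S T U (hS.add hT hU) := by
  obtain rfl := hS.unique hU.left
  obtain rfl := hT.unique hU.right
  rfl

theorem Counts.of_coh {s t : SlotTree I} {S : I → Bool} (h : Counts s S) (m : Coh s t) :
    Counts t S := fun i => (h i).trans ((vars_perm_of_coh m).count_eq i)

theorem assoc_toSparse (hl : l.Nodup) (hl' : ∀ i, i ∈ l) {a b c : SlotTree I} {S : I → Bool}
    (hs : Counts (node (node a b) c) S) (ht : Counts (node a (node b c)) S) :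
    (α_ (a.eval x) (b.eval x) (c.eval x)).hom ≫ toSparse x hl hl' _ S ht =
      toSparse x hl hl' _ S hs := by
  rw [toSparse_node x hl hl' hs.left.left ht.right ht,
    toSparse_node x hl hl' hs.left.right hs.right ht.right,
    toSparse_node x hl hl' hs.left hs.right hs,
    toSparse_node x hl hl' hs.left.left hs.left.right hs.left]
  exact tensorHom_sparseMul_assoc x l _ _ _ _ _ _ _

theorem leftUnit_toSparse (hl : l.Nodup) (hl' : ∀ i, i ∈ l) {a : SlotTree I} {S : I → Bool}
    (hs : Counts (node unit a) S) (ht : Counts a S) :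
    (λ_ (a.eval x)).hom ≫ toSparse x hl hl' _ S ht = toSparse x hl hl' _ S hs := by
  rw [toSparse_node x hl hl' hs.left ht hs, MonoidalCategory.tensorHom_def', Category.assoc]
  exact (leftUnitor_naturality _).symm.trans
    (congrArg (_ ≫ ·) (sparseOne_mul x l hs.left.eq_false _).symm)

theorem rightUnit_toSparse (hl : l.Nodup) (hl' : ∀ i, i ∈ l) {a : SlotTree I} {S : I → Bool}
    (hs : Counts (node a unit) S) (ht : Counts a S) :
    (ρ_ (a.eval x)).hom ≫ toSparse x hl hl' _ S ht = toSparse x hl hl' _ S hs := by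
  rw [toSparse_node x hl hl' ht hs.right hs, MonoidalCategory.tensorHom_def, Category.assoc]
  exact (rightUnitor_naturality _).symm.trans
    (congrArg (_ ≫ ·) (mul_sparseOne x l hs.right.eq_false _).symm)

/-- Multiplying out is compatible with the structure isomorphisms. -/
theorem eval_toSparse (hl : l.Nodup) (hl' : ∀ i, i ∈ l) {s t : SlotTree I} (m : Coh s t)
    {S : I → Bool} (hs : Counts s S) (ht : Counts t S) :
    m.eval x ≫ toSparse x hl hl' t S ht = toSparse x hl hl' s S hs := by
  induction m generalizing S with
  | id a => exact Category.id_comp _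
  | comp f g ihf ihg =>
    -- A formal composite only permutes the variables, so the same `S` counts those of the
    -- intermediate word.
    rw [Coh.eval, Category.assoc, ihg (hs.of_coh f), ihf]
  | tensor f g ihf ihg =>
    rw [toSparse_node x hl hl' hs.left hs.right hs,
      toSparse_node x hl hl' (hs.left.of_coh f) (hs.right.of_coh g) ht,
      ← ihf hs.left (hs.left.of_coh f), ← ihg hs.right (hs.right.of_coh g),
      ← tensorHom_comp_tensorHom, Category.assoc]
    rfl
  | assoc a b c => exact assoc_toSparse x hl hl' hs ht
  | assocInv a b c => exact (Iso.inv_comp_eq _).2 (assoc_toSparse x hl hl' ht hs).symm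
  | leftUnit a => exact leftUnit_toSparse x hl hl' hs ht
  | leftUnitInv a => exact (Iso.inv_comp_eq _).2 (leftUnit_toSparse x hl hl' ht hs).symm
  | rightUnit a => exact rightUnit_toSparse x hl hl' hs ht
  | rightUnitInv a => exact (Iso.inv_comp_eq _).2 (rightUnit_toSparse x hl hl' ht hs).symm
  | swap a b =>
    rw [toSparse_node x hl hl' hs.left hs.right hs, toSparse_node x hl hl' hs.right hs.left ht,
      Coh.eval, ← sparseMul_comm x l (hs.left.add hs.right hs) (hs.right.add hs.left ht)]
    exact (BraidedCategory.braiding_naturality_assoc _ _ _).symm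

/-- **Coherence**: formal composites of structure isomorphisms between words without repeated
variables have the same value. -/
theorem coh_eval_unique {I : Type} [Finite I] (x : I → C) {s t : SlotTree I} (hs : s.vars.Nodup)
    (m m' : Coh s t) : m.eval x = m'.eval x := by
  classical
  have := Fintype.ofFinite I
  have h : Counts s (occurs s) := fun i => toNat_occurs (List.nodup_iff_count_le_one.1 hs i)
  -- The list is that of all variables. Multiplying out `t` is invertible, and followed by it both
  -- composites become multiplying out `s`.
  rw [← cancel_mono (toSparse x (Finset.nodup_toList Finset.univ) (by simp) t _ (h.of_coh m)),
    eval_toSparse x _ _ m h, eval_toSparse x _ _ m' h]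

end Coherence

/-! ## Canonical morphisms -/

namespace SlotTree

variable {I J K : Type}

theorem bind_bind (t : SlotTree I) (u : I → SlotTree J) (w : J → SlotTree K) :
    (t.bind u).bind w = t.bind fun i => (u i).bind w := by
  induction t with
  | unit => rfl
  | leaf i => rfl
  | node a b ha hb => simp only [bind, ha, hb]

theorem relabel_bind (t : SlotTree I) (e : I → J) (w : J → SlotTree K) :
    (t.relabel e).bind w = t.bind fun i => w (e i) :=
  bind_bind _ _ _

theorem bind_leaf (t : SlotTree I) : t.bind leaf = t := by
  induction t with
  | unit => rfl
  | leaf i => rfl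
  | node a b ha hb => simp only [bind, ha, hb]

variable {C : Type u} [Category.{v} C] [MonoidalCategory C]

theorem evalMap_comp (t : SlotTree I) {x y z : I → C} (f : ∀ i, x i ⟶ y i) (g : ∀ i, y i ⟶ z i) :
    (t.evalMap fun i => f i ≫ g i) = t.evalMap f ≫ t.evalMap g := by
  induction t with
  | unit => exact (Category.id_comp _).symm
  | leaf i => rfl
  | node a b ha hb =>
    dsimp only [evalMap, SlotTree.eval]
    rw [ha, hb, tensorHom_comp_tensorHom]

theorem arrow_mk_tensorHom {A A' B B' X X' Y Y' : C} {f : A ⟶ B} {f' : A' ⟶ B'} {g : X ⟶ Y}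
    {g' : X' ⟶ Y'} (hf : Arrow.mk f = Arrow.mk f') (hg : Arrow.mk g = Arrow.mk g') :
    Arrow.mk (f ⊗ₘ g) = Arrow.mk (f' ⊗ₘ g') := by
  cases hf
  cases hg
  rfl

-- Equalities between morphisms whose ends agree only propositionally are proved in the arrow
-- category, where induction on words is painless; this turns them into commuting squares.
omit [MonoidalCategory C] in
theorem comp_eqToHom_of_arrow_mk {A A' B B' : C} {f : A ⟶ B} {f' : A' ⟶ B'}
    (hf : Arrow.mk f = Arrow.mk f') (hA : A = A') (hB : B = B') :
    f ≫ eqToHom hB = eqToHom hA ≫ f' := by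
  cases hf
  simp

theorem evalMap_congr (t : SlotTree I) {x y x' y' : I → C} {f : ∀ i, x i ⟶ y i}
    {g : ∀ i, x' i ⟶ y' i} (h : ∀ i, Arrow.mk (f i) = Arrow.mk (g i)) :
    Arrow.mk (t.evalMap f) = Arrow.mk (t.evalMap g) := by
  induction t with
  | unit => rfl
  | leaf i => exact h i
  | node a b ha hb => exact arrow_mk_tensorHom ha hb

theorem evalMap_bind (t : SlotTree I) (u : I → SlotTree J) {x y : J → C} (f : ∀ i, x i ⟶ y i) :
    Arrow.mk ((t.bind u).evalMap f) = Arrow.mk (t.evalMap fun i => (u i).evalMap f) := by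
  induction t with
  | unit => rfl
  | leaf i => rfl
  | node a b ha hb => exact arrow_mk_tensorHom ha hb

end SlotTree

/-! ### Naturality and closure properties of canonical morphisms -/

variable {C : Type u} [Category.{v} C] [MonoidalCategory C] [SymmetricCategory C]

theorem Coh.eval_naturality {I : Type} {x y : I → C} (f : ∀ i, x i ⟶ y i) {s t : SlotTree I}
    (m : Coh s t) : m.eval x ≫ t.evalMap f = s.evalMap f ≫ m.eval y := by
  induction m with
  | id a => exact (Category.id_comp _).trans (Category.comp_id _).symm
  | comp g h ihg ihh => rw [Coh.eval, Coh.eval, Category.assoc, ihh, reassoc_of% ihg]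
  | tensor g h ihg ihh =>
    dsimp only [Coh.eval, SlotTree.evalMap, SlotTree.eval]
    rw [tensorHom_comp_tensorHom, tensorHom_comp_tensorHom, ihg, ihh]
  | assoc a b c => exact (associator_naturality _ _ _).symm
  | assocInv a b c => exact (associator_inv_naturality _ _ _).symm
  | leftUnit a =>
    dsimp only [Coh.eval, SlotTree.evalMap, SlotTree.eval]
    rw [id_tensorHom, leftUnitor_naturality]
  | leftUnitInv a =>
    dsimp only [Coh.eval, SlotTree.evalMap, SlotTree.eval]
    rw [id_tensorHom, leftUnitor_inv_naturality]
  | rightUnit a =>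
    dsimp only [Coh.eval, SlotTree.evalMap, SlotTree.eval]
    rw [tensorHom_id, rightUnitor_naturality]
  | rightUnitInv a =>
    dsimp only [Coh.eval, SlotTree.evalMap, SlotTree.eval]
    rw [tensorHom_id, rightUnitor_inv_naturality]
  | swap a b => exact (BraidedCategory.braiding_naturality _ _).symm

/-- The morphism `f` is, up to equality of objects, the value at `x` of a formal coherence
isomorphism from `s` to `t`. -/
def IsCan {I : Type} (x : I → C) {A B : C} (f : A ⟶ B) (s t : SlotTree I) : Prop :=
  ∃ (hA : A = s.eval x) (hB : t.eval x = B) (m : Coh s t),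
    f = eqToHom hA ≫ m.eval x ≫ eqToHom hB

namespace IsCan

variable {I J : Type} {x : I → C} {A B A' B' : C} {s t r s' t' : SlotTree I}

theorem of_coh (m : Coh s t) : IsCan x (m.eval x) s t := ⟨rfl, rfl, m, by simp⟩

theorem comp {D : C} {f : A ⟶ B} {g : B ⟶ D} (hf : IsCan x f s t) (hg : IsCan x g t r) :
    IsCan x (f ≫ g) s r := by
  obtain ⟨rfl, rfl, m, rfl⟩ := hf
  obtain ⟨_, rfl, m', rfl⟩ := hg
  exact ⟨rfl, rfl, m.comp m', by simp [Coh.eval]⟩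

theorem congr_right {f : A ⟶ B} (hf : IsCan x f s t) (h : t = r) : IsCan x f s r := h ▸ hf

theorem eqToHom (h : A = B) (hA : A = s.eval x) : IsCan x (eqToHom h) s s := by
  subst h hA
  exact ⟨rfl, rfl, .id s, by simp [Coh.eval]⟩

theorem id (hA : A = s.eval x) : IsCan x (𝟙 A) s s := IsCan.eqToHom rfl hA

theorem tensor {f : A ⟶ B} {g : A' ⟶ B'} (hf : IsCan x f s t) (hg : IsCan x g s' t') :
    IsCan x (f ⊗ₘ g) (node s s') (node t t') := by
  obtain ⟨rfl, rfl, m, rfl⟩ := hf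
  obtain ⟨rfl, rfl, m', rfl⟩ := hg
  refine ⟨rfl, rfl, m.tensor m', ?_⟩
  simp only [eqToHom_refl, Category.comp_id, Category.id_comp]
  exact ((Category.id_comp _).trans (Category.comp_id _)).symm

/-- The point where coherence enters: equations between canonical maps reduce to matching their
source and target words. -/
theorem unique [Finite I] (hs : s.vars.Nodup) {f g : A ⟶ B} (hf : IsCan x f s t)
    (hg : IsCan x g s t) : f = g := by
  obtain ⟨_, _, m, rfl⟩ := hf
  obtain ⟨_, _, m', rfl⟩ := hg
  rw [coh_eval_unique x hs m m']

theorem evalMap {y z : J → C} {f : ∀ i, y i ⟶ z i} {u w : J → SlotTree I} (t : SlotTree J)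
    (h : ∀ i, IsCan x (f i) (u i) (w i)) : IsCan x (t.evalMap f) (t.bind u) (t.bind w) := by
  induction t with
  | unit => exact id rfl
  | leaf i => exact h i
  | node a b ha hb => exact ha.tensor hb

theorem assoc (hr : A = r.eval x) (hs : A' = s.eval x) (ht : B = t.eval x) :
    IsCan x (α_ A A' B).hom (node (node r s) t) (node r (node s t)) := by
  subst hr hs ht
  exact of_coh (.assoc _ _ _)

theorem assocInv (hr : A = r.eval x) (hs : A' = s.eval x) (ht : B = t.eval x) :
    IsCan x (α_ A A' B).inv (node r (node s t)) (node (node r s) t) := by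
  subst hr hs ht
  exact of_coh (.assocInv _ _ _)

theorem leftUnit (hs : A = s.eval x) : IsCan x (λ_ A).hom (node unit s) s := by
  subst hs
  exact of_coh (.leftUnit _)

theorem leftUnitInv (hs : A = s.eval x) : IsCan x (λ_ A).inv s (node unit s) := by
  subst hs
  exact of_coh (.leftUnitInv _)

theorem rightUnit (hs : A = s.eval x) : IsCan x (ρ_ A).hom (node s unit) s := by
  subst hs
  exact of_coh (.rightUnit _)

theorem rightUnitInv (hs : A = s.eval x) : IsCan x (ρ_ A).inv s (node s unit) := by
  subst hs
  exact of_coh (.rightUnitInv _)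

theorem swap (hs : A = s.eval x) (ht : B = t.eval x) :
    IsCan x (β_ A B).hom (node s t) (node t s) := by
  subst hs ht
  exact of_coh (.swap _ _)

/-- Substituting words for the variables turns each structure isomorphism into an instance of the
same kind. The result is an `IsCan` because `eval_bind` is an equality of objects that need not hold
by definition. -/
theorem bind (u : J → SlotTree I) {y : J → C} (hy : ∀ i, y i = (u i).eval x) {s t : SlotTree J}
    (m : Coh s t) : IsCan x (m.eval y) (s.bind u) (t.bind u) := by
  obtain rfl : y = fun i => (u i).eval x := funext hy
  induction m with
  | id a => exact id (eval_bind _ _ _).symm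
  | comp f g ihf ihg => exact ihf.comp ihg
  | tensor f g ihf ihg => exact ihf.tensor ihg
  | assoc a b c => exact assoc (eval_bind _ _ _).symm (eval_bind _ _ _).symm (eval_bind _ _ _).symm
  | assocInv a b c =>
    exact assocInv (eval_bind _ _ _).symm (eval_bind _ _ _).symm (eval_bind _ _ _).symm
  | leftUnit a => exact leftUnit (eval_bind _ _ _).symm
  | leftUnitInv a => exact leftUnitInv (eval_bind _ _ _).symm
  | rightUnit a => exact rightUnit (eval_bind _ _ _).symm
  | rightUnitInv a => exact rightUnitInv (eval_bind _ _ _).symm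
  | swap a b => exact swap (eval_bind _ _ _).symm (eval_bind _ _ _).symm

end IsCan

/-! ### The operad action in terms of canonical morphisms -/

namespace Y

theorem act_eq {n : ℕ} {s t : Y n} (a : s ⟶ t) (m : Coh s.tree t.tree) (x : Fin n → C) :
    Y.act a x = m.eval x :=
  coh_eval_unique x s.linear.1 _ m

theorem act_naturality {n : ℕ} {s t : Y n} (a : s ⟶ t) {x y : Fin n → C} (f : ∀ i, x i ⟶ y i) :
    Y.act a x ≫ t.map f = s.map f ≫ Y.act a y :=
  Coh.eval_naturality _ _

omit [SymmetricCategory C] in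
theorem map_comp {n : ℕ} (s : Y n) {x y z : Fin n → C} (f : ∀ i, x i ⟶ y i)
    (g : ∀ i, y i ⟶ z i) : (s.map fun i => f i ≫ g i) = s.map f ≫ s.map g :=
  evalMap_comp _ _ _

omit [SymmetricCategory C] in
theorem perm_map {n : ℕ} (s : Y n) (σ : Equiv.Perm (Fin n)) {x y : Fin n → C}
    (f : ∀ i, x i ⟶ y i) :
    (s.perm σ).map (x := x ∘ σ) (y := y ∘ σ) (fun i => f (σ i)) ≫ eqToHom (obj_perm s σ y) =
      eqToHom (obj_perm s σ x) ≫ s.map f := by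
  refine comp_eqToHom_of_arrow_mk ((evalMap_bind _ _ _).trans (evalMap_congr _ fun i => ?_)) _ _
  exact congrArg (fun j => Arrow.mk (f j)) (σ.apply_symm_apply i)

omit [SymmetricCategory C] in
theorem gamma_map {n : ℕ} {j : Fin n → ℕ} (r : Y n) (t : ∀ s, Y (j s)) {x y : ∀ s, Fin (j s) → C}
    (f : ∀ s k, x s k ⟶ y s k) :
    (r.gamma t).map (x := concat x) (y := concat y)
        (fun p => f (finSigmaFinEquiv.symm p).1 (finSigmaFinEquiv.symm p).2) ≫
        eqToHom (obj_gamma r t y) =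
      eqToHom (obj_gamma r t x) ≫ r.map fun s => (t s).map (f s) := by
  refine comp_eqToHom_of_arrow_mk ((evalMap_bind _ _ _).trans (evalMap_congr _ fun s =>
    (evalMap_bind _ _ _).trans (evalMap_congr _ fun k => ?_))) _ _
  exact congrArg (fun p : Σ s, Fin (j s) => Arrow.mk (f p.1 p.2))
    (finSigmaFinEquiv.symm_apply_apply ⟨s, k⟩)

/-- The entries `x i` may themselves be values of words in further variables, which is how nested
composites are compared over a single index type `J`. -/
theorem isCan_act {n : ℕ} {J : Type} {X : J → C} {x : Fin n → C} (u : Fin n → SlotTree J)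
    (hx : ∀ i, x i = (u i).eval X) {s t : Y n} (a : s ⟶ t) :
    IsCan X (Y.act a x) (s.tree.bind u) (t.tree.bind u) :=
  IsCan.bind _ hx _

theorem isCan_perm {n : ℕ} {J : Type} {X : J → C} {x : Fin n → C} {σ : Equiv.Perm (Fin n)}
    (u : Fin n → SlotTree J) (hx : ∀ i, x (σ i) = (u i).eval X) {s t : Y n} (a : s ⟶ t.perm σ) :
    IsCan X (Y.act a (x ∘ σ) ≫ eqToHom (obj_perm t σ x)) (s.tree.bind u)
      (t.tree.bind (u ∘ σ.symm)) := by
  have h : t.tree.bind (u ∘ σ.symm) = (t.perm σ).tree.bind u :=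
    (relabel_bind t.tree σ.symm u).symm
  rw [h]
  refine (isCan_act u hx a).comp (IsCan.eqToHom _ ?_)
  rw [eval_bind]
  exact congrArg _ (funext hx)

theorem isCan_gamma {n : ℕ} {j : Fin n → ℕ} {J : Type} {X : J → C} {x : ∀ i, Fin (j i) → C}
    (u : Fin (∑ i, j i) → SlotTree J) (hx : ∀ p, concat x p = (u p).eval X) {s : Y (∑ i, j i)}
    {r : Y n} {t : ∀ i, Y (j i)} (a : s ⟶ r.gamma t) :
    IsCan X (Y.act a (concat x) ≫ eqToHom (obj_gamma r t x)) (s.tree.bind u)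
      (r.tree.bind fun i => (t i).tree.bind fun k => u (finSigmaFinEquiv ⟨i, k⟩)) := by
  have h : (r.tree.bind fun i => (t i).tree.bind fun k => u (finSigmaFinEquiv ⟨i, k⟩)) =
      (r.gamma t).tree.bind u := by
    dsimp only [gamma]
    rw [bind_bind]
    exact congrArg _ (funext fun i => (relabel_bind _ _ _).symm)
  rw [h]
  refine (isCan_act u hx a).comp (IsCan.eqToHom _ ?_)
  rw [eval_bind]
  exact congrArg _ (funext hx)

/-- Moves a family of morphisms from before a structure map to after it, leaving the canonical part
in front. -/
theorem act_perm_naturality {n : ℕ} {σ : Equiv.Perm (Fin n)} {s t : Y n} (a : s ⟶ t.perm σ)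
    {x y : Fin n → C} (f : ∀ i, x i ⟶ y i) :
    s.map (x := x ∘ σ) (y := y ∘ σ) (fun i => f (σ i)) ≫ Y.act a (y ∘ σ) ≫
        eqToHom (obj_perm t σ y) =
      (Y.act a (x ∘ σ) ≫ eqToHom (obj_perm t σ x)) ≫ t.map f := by
  have h := act_naturality a (x := x ∘ σ) (y := y ∘ σ) fun i => f (σ i)
  rw [← reassoc_of% h, perm_map, Category.assoc]

theorem act_gamma_naturality {n : ℕ} {j : Fin n → ℕ} {s : Y (∑ i, j i)} {r : Y n}
    {t : ∀ i, Y (j i)} (a : s ⟶ r.gamma t) {x y : ∀ s, Fin (j s) → C} (f : ∀ s k, x s k ⟶ y s k) :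
    s.map (x := concat x) (y := concat y)
        (fun p => f (finSigmaFinEquiv.symm p).1 (finSigmaFinEquiv.symm p).2) ≫
        Y.act a (concat y) ≫ eqToHom (obj_gamma r t y) =
      (Y.act a (concat x) ≫ eqToHom (obj_gamma r t x)) ≫ r.map fun s => (t s).map (f s) := by
  have h := act_naturality a (x := concat x) (y := concat y)
    fun p => f (finSigmaFinEquiv.symm p).1 (finSigmaFinEquiv.symm p).2
  rw [← reassoc_of% h, gamma_map, Category.assoc]

theorem nodup_vars_relabel {n : ℕ} {J : Type} (s : Y n) {e : Fin n → J}
    (he : Function.Injective e) : (s.tree.relabel e).vars.Nodup := by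
  rw [vars_relabel]
  exact s.linear.1.map he

end Y

/-! ## Lexicographic order of blocks -/

/-- The position of an entry is the total length of the earlier blocks plus its offset, so an
earlier block always wins. -/
theorem finSigmaFinEquiv_lt {n : ℕ} {j : Fin n → ℕ} {p q : Σ s, Fin (j s)}
    (h : (p.1 : ℕ) < q.1 ∨ p.1 = q.1 ∧ (p.2 : ℕ) < q.2) :
    (finSigmaFinEquiv p : ℕ) < finSigmaFinEquiv q := by
  have key : ∀ p : Σ s, Fin (j s), (finSigmaFinEquiv p : ℕ) =
      ∑ i ∈ Finset.range p.1, (if hi : i < n then j ⟨i, hi⟩ else 0) + p.2 := by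
    intro p
    rw [finSigmaFinEquiv_apply, Finset.sum_range]
    congr 1
    refine Finset.sum_congr rfl fun i _ => ?_
    rw [dif_pos (i.2.trans p.1.2)]
    rfl
  rw [key, key]
  rcases h with h | ⟨h, h'⟩
  · have h₁ := Finset.sum_le_sum_of_subset (f := fun i => if hi : i < n then j ⟨i, hi⟩ else 0)
      (Finset.range_subset_range.2 (Nat.succ_le_of_lt h))
    rw [Finset.sum_range_succ, dif_pos p.1.2] at h₁
    have := p.2.2
    simp only [Fin.eta] at h₁
    omega
  · rw [congrArg Fin.val h]
    omega

theorem finSigmaFinEquiv_lt_iff {n : ℕ} {j : Fin n → ℕ} {p q : Σ s, Fin (j s)} :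
    finSigmaFinEquiv p < finSigmaFinEquiv q ↔
      (p.1 : ℕ) < q.1 ∨ p.1 = q.1 ∧ (p.2 : ℕ) < q.2 := by
  refine ⟨fun h => ?_, finSigmaFinEquiv_lt⟩
  obtain ⟨s, t⟩ := p
  obtain ⟨s', t'⟩ := q
  rcases lt_trichotomy s s' with hs | rfl | hs
  · exact .inl hs
  · rcases lt_trichotomy t t' with ht | rfl | ht
    · exact .inr ⟨rfl, ht⟩
    · exact absurd h (lt_irrefl _)
    · exact absurd h (Nat.not_lt_of_gt (finSigmaFinEquiv_lt (.inr ⟨rfl, ht⟩)))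
  · exact absurd h (Nat.not_lt_of_gt (finSigmaFinEquiv_lt (.inl hs)))

/-- Two enumerations of `J` that respect the same trichotomous relation differ by a strictly
increasing bijection of `Fin n`, which can only be the identity. Values are compared because `n` and
`n'` need not be syntactically equal. -/
theorem val_eq_of_lex {J : Type} {n n' : ℕ} (e : Fin n ≃ J) (e' : Fin n' ≃ J) (R : J → J → Prop)
    (tri : ∀ p q, R p q ∨ p = q ∨ R q p) (h : ∀ x y, R (e x) (e y) → x < y)
    (h' : ∀ x y, R (e' x) (e' y) → x < y) (i : Fin n) : (e'.symm (e i) : ℕ) = i := by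
  obtain rfl : n = n' := by simpa using Fintype.card_congr (e.trans e'.symm)
  have mono : StrictMono (e'.symm ∘ e) := by
    intro a b hab
    rcases tri (e a) (e b) with hR | hR | hR
    · exact h' _ _ (by simpa using hR)
    · exact absurd (e.injective hR) hab.ne
    · exact absurd (h _ _ hR) hab.not_gt
  have : mono.orderIsoOfSurjective _ (e'.symm.surjective.comp e.surjective) = OrderIso.refl _ :=
    Subsingleton.elim _ _
  exact congrArg Fin.val (DFunLike.congr_fun this i)

variable {C : Type u} [Category.{v} C] [MonoidalCategory C] [SymmetricCategory C]

/-! ## The multicategory axioms -/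

section Axioms

variable (κ : Choice C)

/-- The common form of the axioms: `e` and `e'` label the two source tuples by `J`, `he` says that
the labels come in the same order, and both sides are a canonical map into the same word `T`
followed by a shared remainder `r`. -/
theorem arrow_eq {J : Type} (X : J → C) {n n' : ℕ} {x : Fin n → C} {x' : Fin n' → C}
    (e : Fin n ≃ J) (e' : Fin n' ≃ J) (hx : ∀ i, x i = X (e i)) (hx' : ∀ i, x' i = X (e' i))
    (he : ∀ i, (e'.symm (e i) : ℕ) = i) {A y : C} {T : SlotTree J} {p : κ.bar x ⟶ A}
    {q : κ.bar x' ⟶ A} (hp : IsCan X p ((κ n x).tree.relabel e) T)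
    (hq : IsCan X q ((κ n' x').tree.relabel e') T) (r : A ⟶ y) {f : κ.bar x ⟶ y}
    {g : κ.bar x' ⟶ y} (hf : f = p ≫ r) (hg : g = q ≫ r) :
    (U κ).arrow (x := x) (y := y) f = (U κ).arrow (x := x') (y := y) g := by
  obtain rfl : n = n' := by simpa using Fintype.card_congr (e.trans e'.symm)
  obtain rfl : e = e' := Equiv.ext fun i => e'.symm.injective <| by
    rw [Equiv.symm_apply_apply]
    exact Fin.ext (he i)
  obtain rfl : x = x' := funext fun i => (hx i).trans (hx' i).symm
  have := Finite.of_equiv _ e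
  rw [hf, hg, hp.unique (Y.nodup_vars_relabel _ e.injective) hq]

variable {n : ℕ} {j : Fin n → ℕ} {d : C} {c : Fin n → C} {b : ∀ s, Fin (j s) → C}

theorem U_perm_eq (σ : Equiv.Perm (Fin n)) (f : κ.bar c ⟶ d) :
    (U κ).perm (x := c) (y := d) σ f =
      (Y.act (default : κ n (c ∘ σ) ⟶ (κ n c).perm σ) (c ∘ σ) ≫
        eqToHom ((κ n c).obj_perm σ c)) ≫ f :=
  (Category.assoc _ _ _).symm

theorem U_comp_eq (f : κ.bar c ⟶ d) (g : ∀ s, κ.bar (b s) ⟶ c s) :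
    (U κ).comp (x := b) (y := c) (z := d) f g =
      (Y.act (default : κ _ (concat b) ⟶ (κ n c).gamma fun s => κ (j s) (b s)) (concat b) ≫
        eqToHom ((κ n c).obj_gamma _ b)) ≫ (κ n c).map g ≫ f :=
  (Category.assoc _ _ _).symm

theorem U_perm_one (f : κ.bar c ⟶ d) : (U κ).perm (x := c) (y := d) 1 f = f := by
  have h : IsCan c (Y.act (default : κ n (c ∘ (1 : Equiv.Perm (Fin n))) ⟶ (κ n c).perm 1)
      (c ∘ (1 : Equiv.Perm (Fin n))) ≫ eqToHom ((κ n c).obj_perm 1 c))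
      ((κ n c).tree.bind leaf) ((κ n c).tree.bind leaf) :=
    Y.isCan_perm leaf (fun _ => rfl) _
  have h' : IsCan c (𝟙 (κ.bar c)) ((κ n c).tree.bind leaf) ((κ n c).tree.bind leaf) :=
    IsCan.id (by rw [bind_leaf]; rfl)
  refine (U_perm_eq κ 1 f).trans ?_
  refine (congrArg (· ≫ f) (h.unique ?_ h')).trans (Category.id_comp f)
  rw [bind_leaf]
  exact (κ n c).linear.1

theorem U_perm_mul (σ τ : Equiv.Perm (Fin n)) (f : κ.bar c ⟶ d) :
    (U κ).perm (x := c ∘ σ) (y := d) τ ((U κ).perm (x := c) (y := d) σ f) =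
      (U κ).perm (x := c) (y := d) (σ * τ) f := by
  have h₁ := Y.isCan_perm (X := (c ∘ σ) ∘ τ) (x := c ∘ σ) (σ := τ) leaf (fun _ => rfl)
    (default : κ n ((c ∘ σ) ∘ τ) ⟶ (κ n (c ∘ σ)).perm τ)
  have h₂ := Y.isCan_perm (X := (c ∘ σ) ∘ τ) (x := c) (σ := σ) (leaf ∘ τ.symm)
    (fun i => by simp [SlotTree.eval]) (default : κ n (c ∘ σ) ⟶ (κ n c).perm σ)
  have h₃ := Y.isCan_perm (X := (c ∘ σ) ∘ τ) (x := c) (σ := σ * τ) leaf (fun _ => rfl)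
    (default : κ n (c ∘ ⇑(σ * τ)) ⟶ (κ n c).perm (σ * τ))
  have h := (h₁.comp h₂).unique (by rw [bind_leaf]; exact (κ n _).linear.1) h₃
  refine (U_perm_eq κ τ _).trans ((congrArg (_ ≫ ·) (U_perm_eq κ σ f)).trans ?_)
  exact (Category.assoc _ _ _).symm.trans
    ((congrArg (· ≫ f) h).trans (U_perm_eq κ (σ * τ) f).symm)

/-- Identities are themselves canonical, so everything before `f` is. -/
theorem U_comp_id (f : κ.bar c ⟶ d) :
    (U κ).arrow ((U κ).comp (y := c) (z := d) f fun s => (U κ).id (c s)) =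
      (U κ).arrow (x := c) (y := d) f := by
  let e : Fin (∑ _ : Fin n, 1) ≃ Fin n := finSigmaFinEquiv.symm.trans (Equiv.sigmaUnique _ _)
  have h₁ := Y.isCan_gamma (X := c) (x := fun s (_ : Fin 1) => c s) (leaf ∘ e) (fun _ => rfl)
    (default : κ _ (concat fun s (_ : Fin 1) => c s) ⟶ (κ n c).gamma fun s => κ 1 fun _ => c s)
  have h₂ := IsCan.evalMap (x := c) (κ n c).tree fun s =>
    Y.isCan_act (X := c) (x := fun _ => c s) (fun k => (leaf ∘ e) (finSigmaFinEquiv ⟨s, k⟩))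
      (fun k => by simp [e, SlotTree.eval]) (default : κ 1 (fun _ => c s) ⟶ Y.one)
  refine arrow_eq κ c e (Equiv.refl _) (fun _ => rfl) (fun _ => rfl) (fun i => ?_)
    ((h₁.comp h₂).congr_right ?_) (IsCan.id (eval_relabel _ _ _).symm) f
    ((U_comp_eq κ _ _).trans (Category.assoc _ _ _).symm) (Category.id_comp _).symm
  · obtain ⟨⟨s, k⟩, rfl⟩ := finSigmaFinEquiv.surjective i
    simp [e, finSigmaFinEquiv_apply]
  · refine congrArg _ (funext fun s => ?_)
    simp [Y.one, SlotTree.bind, e]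

theorem U_id_comp (f : κ.bar c ⟶ d) :
    (U κ).arrow ((U κ).comp (x := fun _ : Fin 1 => c) ((U κ).id d) fun _ => f) =
      (U κ).arrow (x := c) (y := d) f := by
  let X : (Σ _ : Fin 1, Fin n) → C := fun p => c p.2
  let e' : Fin n ≃ Σ _ : Fin 1, Fin n := (Equiv.uniqueSigma fun _ : Fin 1 => Fin n).symm
  have h₁ := Y.isCan_gamma (X := X) (x := fun _ : Fin 1 => c)
    (leaf ∘ finSigmaFinEquiv.symm) (fun _ => rfl)
    (default : κ _ (concat fun _ : Fin 1 => c) ⟶ (κ 1 fun _ => d).gamma fun _ => κ n c)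
  have h₂ := Y.isCan_act (X := X) (x := fun _ => κ.bar c)
    (fun s : Fin 1 => (κ n c).tree.bind fun k =>
      (leaf ∘ finSigmaFinEquiv.symm) (finSigmaFinEquiv (⟨s, k⟩ : Σ _ : Fin 1, Fin n)))
    (fun s => by
      rw [eval_bind]
      exact congrArg (κ n c).tree.eval (funext fun k => by simp [X, SlotTree.eval]))
    (default : κ 1 (fun _ => d) ⟶ Y.one)
  refine arrow_eq κ X (x' := c) finSigmaFinEquiv.symm e' (fun _ => rfl) (fun _ => rfl)
    (fun i => ?_) ((h₁.comp h₂).congr_right ?_)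
    (IsCan.id (eval_relabel e' (κ n c).tree X).symm) f
    ((U_comp_eq κ _ _).trans ?_) (Category.id_comp _).symm
  · obtain ⟨⟨s, k⟩, rfl⟩ := finSigmaFinEquiv.surjective i
    rw [Equiv.symm_apply_apply, finSigmaFinEquiv_one]
    obtain rfl : s = default := Subsingleton.elim _ _
    exact congrArg Fin.val (e'.symm_apply_apply k)
  · refine congrArg (κ n c).tree.bind (funext fun k => ?_)
    simp [e']
  -- Naturality of the map from `κ 1` to the operad unit carries `f` to the end, where it becomes
  -- the shared remainder.
  · have h := Y.act_naturality (default : κ 1 (fun _ => d) ⟶ Y.one) (x := fun _ => κ.bar c)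
      (y := fun _ => d) fun _ => f
    exact (congrArg (_ ≫ ·) h.symm).trans (Category.assoc _ _ _).symm

theorem U_comp_perm (τ : ∀ s, Equiv.Perm (Fin (j s))) (f : κ.bar c ⟶ d)
    (g : ∀ s, κ.bar (b s) ⟶ c s) :
    (U κ).arrow ((U κ).comp (y := c) (z := d) f
        fun s => (U κ).perm (x := b s) (y := c s) (τ s) (g s)) =
      (U κ).arrow ((U κ).perm (MulticategoryData.sumPerm τ)
        ((U κ).comp (x := b) (y := c) (z := d) f g)) := by
  let X : (Σ s, Fin (j s)) → C := fun p => b p.1 p.2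
  let e : Fin (∑ s, j s) ≃ Σ s, Fin (j s) :=
    finSigmaFinEquiv.symm.trans (Equiv.sigmaCongrRight τ)
  have h₁ := Y.isCan_gamma (X := X) (x := fun s => b s ∘ τ s) (leaf ∘ e) (fun _ => rfl)
    (default : κ _ (concat fun s => b s ∘ τ s) ⟶ (κ n c).gamma fun s => κ _ (b s ∘ τ s))
  have h₂ := IsCan.evalMap (x := X) (κ n c).tree fun s =>
    Y.isCan_perm (X := X) (x := b s) (σ := τ s) (fun k => (leaf ∘ e) (finSigmaFinEquiv ⟨s, k⟩))
      (fun k => by simp [e, SlotTree.eval, X]) (default : κ _ (b s ∘ τ s) ⟶ (κ _ (b s)).perm (τ s))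
  have h₃ := Y.isCan_perm (X := X) (x := concat b) (σ := MulticategoryData.sumPerm τ) (leaf ∘ e)
    (fun p => congrArg X (finSigmaFinEquiv.symm_apply_apply (e p)))
    (default : κ _ (concat b ∘ MulticategoryData.sumPerm τ) ⟶ (κ _ (concat b)).perm _)
  have h₄ := Y.isCan_gamma (X := X) (x := b) ((leaf ∘ e) ∘ (MulticategoryData.sumPerm τ).symm)
    (fun p => by simp [e, SlotTree.eval, X, concat, MulticategoryData.sumPerm])
    (default : κ _ (concat b) ⟶ (κ n c).gamma fun s => κ _ (b s))
  refine arrow_eq κ X e e (fun _ => rfl) (fun p => ?_)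
    (fun i => congrArg Fin.val (e.symm_apply_apply i))
    ((h₁.comp h₂).congr_right ?_) (h₃.comp h₄) ((κ n c).map g ≫ f)
    ((U_comp_eq κ _ _).trans ?_) ((U_perm_eq κ _ _).trans ?_)
  · exact congrArg X (finSigmaFinEquiv.symm_apply_apply (e p))
  · refine congrArg _ (funext fun s => congrArg _ (funext fun k => ?_))
    simp [e, MulticategoryData.sumPerm]
  · refine Eq.trans (congrArg (_ ≫ ·) ?_) (Category.assoc _ _ _).symm
    refine Eq.trans (congrArg (· ≫ f) ?_) (Category.assoc _ _ _)
    exact (congrArg (κ n c).map (funext fun s => U_perm_eq κ (τ s) (g s))).trans (Y.map_comp _ _ _)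
  · exact (congrArg (_ ≫ ·) (U_comp_eq κ f g)).trans (Category.assoc _ _ _).symm

theorem U_perm_comp (σ : Equiv.Perm (Fin n)) (f : κ.bar c ⟶ d)
    (g : ∀ s, κ.bar (b s) ⟶ c s) :
    (U κ).arrow ((U κ).comp (x := fun s => b (σ s)) ((U κ).perm (x := c) (y := d) σ f)
        fun s => g (σ s)) =
      (U κ).arrow ((U κ).perm (MulticategoryData.blockPerm j σ)
        ((U κ).comp (x := b) (y := c) (z := d) f g)) := by
  let X : (Σ s, Fin (j s)) → C := fun p => b p.1 p.2
  let e : Fin (∑ s, j (σ s)) ≃ Σ s, Fin (j s) :=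
    finSigmaFinEquiv.symm.trans (Equiv.sigmaCongrLeft (β := fun s => Fin (j s)) σ)
  let e' : Fin (∑ s, j s) ≃ Σ s, Fin (j s) :=
    (MulticategoryData.blockPerm j σ).trans finSigmaFinEquiv.symm
  have h₁ := Y.isCan_gamma (X := X) (x := fun s => b (σ s)) (leaf ∘ e) (fun _ => rfl)
    (default : κ _ (concat fun s => b (σ s)) ⟶ (κ n (c ∘ σ)).gamma fun s => κ _ (b (σ s)))
  have h₂ := Y.isCan_perm (X := X) (x := fun s => κ.bar (b s)) (σ := σ)
    (fun s => (κ _ (b (σ s))).tree.bind fun k => (leaf ∘ e) (finSigmaFinEquiv ⟨s, k⟩))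
    (fun s => by
      rw [eval_bind]
      exact congrArg (κ _ (b (σ s))).tree.eval
        (funext fun k => by simp [e, X, SlotTree.eval]))
    (default : κ n (c ∘ σ) ⟶ (κ n c).perm σ)
  have h₃ := Y.isCan_perm (X := X) (x := concat b) (σ := MulticategoryData.blockPerm j σ)
    (leaf ∘ e') (fun p => rfl)
    (default : κ _ (concat b ∘ MulticategoryData.blockPerm j σ) ⟶ (κ _ (concat b)).perm _)
  have h₄ := Y.isCan_gamma (X := X) (x := b)
    ((leaf ∘ e') ∘ (MulticategoryData.blockPerm j σ).symm)
    (fun p => by simp [e', SlotTree.eval, X, concat])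
    (default : κ _ (concat b) ⟶ (κ n c).gamma fun s => κ _ (b s))
  refine arrow_eq κ X e e' (fun _ => rfl) (fun p => rfl) (fun i => ?_)
    ((h₁.comp h₂).congr_right ?_) (h₃.comp h₄) ((κ n c).map g ≫ f)
    ((U_comp_eq κ _ _).trans ?_) ((U_perm_eq κ _ _).trans ?_)
  · have h : e i = e' (finCongr (Equiv.sum_comp σ j) i) := by
      simp [e, e', MulticategoryData.blockPerm]
    rw [h, Equiv.symm_apply_apply]
    rfl
  · refine congrArg _ (funext fun s => ?_)
    obtain ⟨s, rfl⟩ := σ.surjective s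
    -- The types of the inner words depend on the block, so `σ.symm (σ s)` is generalized before it
    -- is identified with `s`.
    have : ∀ s' (h : s' = s), ((κ _ (b (σ s'))).tree.bind fun k =>
        (leaf ∘ e) (finSigmaFinEquiv ⟨s', k⟩)) = (κ _ (b (σ s))).tree.bind fun k =>
        ((leaf ∘ e') ∘ (MulticategoryData.blockPerm j σ).symm) (finSigmaFinEquiv ⟨σ s, k⟩) := by
      rintro _ rfl
      exact congrArg _ (funext fun k => by simp [e, e'])
    exact this _ (σ.symm_apply_apply s)
  · refine (congrArg (_ ≫ _ ≫ ·) (U_perm_eq κ σ f)).trans ?_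
    refine Eq.trans (congrArg (_ ≫ ·) ?_) (Category.assoc _ _ _).symm
    have := Y.act_perm_naturality (default : κ n (c ∘ σ) ⟶ (κ n c).perm σ) g
    refine (Category.assoc _ _ _).symm.trans ((congrArg (· ≫ f) this).trans (Category.assoc _ _ _))
  · exact (congrArg (_ ≫ ·) (U_comp_eq κ f g)).trans (Category.assoc _ _ _).symm

theorem U_assoc {k : ∀ s, Fin (j s) → ℕ} {a : ∀ s t, Fin (k s t) → C} (f : κ.bar c ⟶ d)
    (g : ∀ s, κ.bar (b s) ⟶ c s) (h : ∀ s t, κ.bar (a s t) ⟶ b s t) :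
    (U κ).arrow ((U κ).comp
        (x := fun p => a (finSigmaFinEquiv.symm p).1 (finSigmaFinEquiv.symm p).2)
        ((U κ).comp (x := b) (y := c) (z := d) f g)
        fun p => h (finSigmaFinEquiv.symm p).1 (finSigmaFinEquiv.symm p).2) =
      (U κ).arrow ((U κ).comp (y := c) (z := d) f
        fun s => (U κ).comp (x := a s) (y := b s) (z := c s) (g s) (h s)) := by
  -- The entries of all tuples `a s t`, labelled by `((s, t), r)`. The two sides flatten this set in
  -- two different ways, given by `e` and `e'`.
  let J : Type := Σ q : (Σ s, Fin (j s)), Fin (k q.1 q.2)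
  let X : J → C := fun p => a p.1.1 p.1.2 p.2
  let a' : ∀ p : Fin (∑ s, j s), Fin (k (finSigmaFinEquiv.symm p).1 (finSigmaFinEquiv.symm p).2) → C :=
    fun p => a (finSigmaFinEquiv.symm p).1 (finSigmaFinEquiv.symm p).2
  let e : Fin (∑ p : Fin (∑ s, j s), k (finSigmaFinEquiv.symm p).1 (finSigmaFinEquiv.symm p).2) ≃ J :=
    finSigmaFinEquiv.symm.trans
      (Equiv.sigmaCongrLeft (β := fun q : (Σ s, Fin (j s)) => Fin (k q.1 q.2)) finSigmaFinEquiv.symm)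
  let e' : Fin (∑ s, ∑ t, k s t) ≃ J :=
    finSigmaFinEquiv.symm.trans
      ((Equiv.sigmaCongrRight fun s => finSigmaFinEquiv.symm).trans (Equiv.sigmaAssoc _).symm)
  let W : (Σ s, Fin (j s)) → SlotTree J := fun q => (κ _ (a q.1 q.2)).tree.bind fun r => leaf ⟨q, r⟩
  have hW : ∀ p, ((κ _ (a' p)).tree.bind fun r => (leaf ∘ e) (finSigmaFinEquiv ⟨p, r⟩)) =
      W (finSigmaFinEquiv.symm p) := fun p =>
    congrArg (κ _ (a' p)).tree.bind (funext fun r => by simp [e]; rfl)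
  have h₁ := Y.isCan_gamma (X := X) (x := a') (leaf ∘ e) (fun _ => rfl)
    (default : κ _ (concat a') ⟶ (κ _ (concat b)).gamma fun p => κ _ (a' p))
  simp only [hW] at h₁
  have h₂ := Y.isCan_gamma (X := X) (x := fun s t => κ.bar (a s t))
    (fun p => W (finSigmaFinEquiv.symm p)) (fun p => (eval_bind (κ _ (a' p)).tree
      (fun r => leaf (⟨finSigmaFinEquiv.symm p, r⟩ : J)) X).symm)
    (default : κ _ (concat b) ⟶ (κ n c).gamma fun s => κ _ (b s))
  have h₃ := Y.isCan_gamma (X := X) (x := fun s => concat (a s)) (leaf ∘ e') (fun _ => rfl)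
    (default : κ _ (concat fun s => concat (a s)) ⟶ (κ n c).gamma fun s => κ _ (concat (a s)))
  have h₄ := IsCan.evalMap (x := X) (κ n c).tree fun s =>
    Y.isCan_gamma (X := X) (x := a s) (fun p => (leaf ∘ e') (finSigmaFinEquiv ⟨s, p⟩))
      (fun p => by simp [e', X, SlotTree.eval, concat]; rfl)
      (default : κ _ (concat (a s)) ⟶ (κ _ (b s)).gamma fun t => κ _ (a s t))
  refine arrow_eq κ X e e' (fun _ => rfl) (fun _ => rfl) (fun i => ?_) (h₁.comp h₂)
    ((h₃.comp h₄).congr_right ?_) ((κ n c).map (fun s => (κ _ (b s)).map (h s) ≫ g s) ≫ f)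
    ((U_comp_eq κ _ _).trans ?_) ((U_comp_eq κ _ _).trans ?_)
  -- Both flattenings are lexicographic in `s`, `t`, `r`; the order of the pairs `(s, t)` is read
  -- off from their position in `∑ s, j s`.
  · refine val_eq_of_lex e e' (fun p q => finSigmaFinEquiv p.1 < finSigmaFinEquiv q.1 ∨
      p.1 = q.1 ∧ (p.2 : ℕ) < q.2) ?_ ?_ ?_ i
    · rintro ⟨p, r⟩ ⟨q, r'⟩
      rcases lt_trichotomy (finSigmaFinEquiv p) (finSigmaFinEquiv q) with hp | hp | hp
      · exact .inl (.inl hp)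
      · obtain rfl := finSigmaFinEquiv.injective hp
        rcases lt_trichotomy r r' with hr | rfl | hr
        · exact .inl (.inr ⟨rfl, hr⟩)
        · exact .inr (.inl rfl)
        · exact .inr (.inr (.inr ⟨rfl, hr⟩))
      · exact .inr (.inr (.inl hp))
    · have he : ∀ p, e (finSigmaFinEquiv p) = ⟨finSigmaFinEquiv.symm p.1, p.2⟩ := fun p => by
        simp [e]
        rfl
      intro x y hxy
      obtain ⟨p, rfl⟩ := finSigmaFinEquiv.surjective x
      obtain ⟨q, rfl⟩ := finSigmaFinEquiv.surjective y
      rw [he, he] at hxy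
      simp only [Equiv.apply_symm_apply, EmbeddingLike.apply_eq_iff_eq] at hxy
      exact finSigmaFinEquiv_lt hxy
    · have he : ∀ q : J, e' (finSigmaFinEquiv ⟨q.1.1, finSigmaFinEquiv ⟨q.1.2, q.2⟩⟩) = q :=
        fun q => by
          simp [e']
          rfl
      intro x y hxy
      obtain ⟨p, rfl⟩ := e'.symm.surjective x
      obtain ⟨q, rfl⟩ := e'.symm.surjective y
      rw [Equiv.apply_symm_apply, Equiv.apply_symm_apply] at hxy
      rw [← he p, ← he q, Equiv.symm_apply_apply, Equiv.symm_apply_apply]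
      obtain ⟨⟨s, t⟩, r⟩ := p
      obtain ⟨⟨s', t'⟩, r'⟩ := q
      refine finSigmaFinEquiv_lt ?_
      rcases hxy with h | ⟨h, hr⟩
      · rcases finSigmaFinEquiv_lt_iff.1 h with h | ⟨h, ht⟩
        · exact .inl h
        · obtain rfl : s = s' := h
          exact .inr ⟨rfl, finSigmaFinEquiv_lt (.inl ht)⟩
      · cases h
        exact .inr ⟨rfl, finSigmaFinEquiv_lt (.inr ⟨rfl, hr⟩)⟩
  · refine congrArg _ (funext fun s => congrArg _ (funext fun t => ?_))
    simp [e', W]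
    rfl
  -- On this side the maps `h` precede the structure map of the composite of `f` and `g`, so they
  -- are moved past it. On the other side functoriality of `κ n c` alone separates the canonical
  -- parts.
  · refine (congrArg (_ ≫ _ ≫ ·) (U_comp_eq κ f g)).trans ?_
    refine Eq.trans (congrArg (_ ≫ ·) ?_) (Category.assoc _ _ _).symm
    have := Y.act_gamma_naturality
      (default : κ _ (concat b) ⟶ (κ n c).gamma fun s => κ _ (b s)) h
    refine (Category.assoc _ _ _).symm.trans ((congrArg (· ≫ _) this).trans
      ((Category.assoc _ _ _).trans (congrArg (_ ≫ ·) ?_)))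
    exact (Category.assoc _ _ _).symm.trans (congrArg (· ≫ f) (Y.map_comp _ _ _).symm)
  · refine Eq.trans (congrArg (_ ≫ ·) ?_) (Category.assoc _ _ _).symm
    refine Eq.trans (congrArg (· ≫ f) ?_) (Category.assoc _ _ _)
    exact (congrArg (κ n c).map (funext fun s => U_comp_eq κ (g s) (h s))).trans (Y.map_comp _ _ _)

end Axioms

theorem isMulticategory_U (κ : Choice C) : (U κ).IsMulticategory where
  perm_one f := U_perm_one κ f
  perm_mul σ τ f := U_perm_mul κ σ τ f
  assoc f g h := U_assoc κ f g h
  comp_id f := U_comp_id κ f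
  id_comp f := U_id_comp κ f
  perm_comp σ f g := U_perm_comp κ σ f g
  comp_perm τ f g := U_comp_perm κ τ f g

/-! ## Change of choice -/

theorem Y.act_comp {n : ℕ} {r s t : Y n} (a : r ⟶ s) (b : s ⟶ t) (c : r ⟶ t) (x : Fin n → C) :
    Y.act a x ≫ Y.act b x = Y.act c x :=
  coh_eval_unique x r.linear.1 (.comp (Classical.choice (Coh.nonempty_of_linear r.linear s.linear))
    (Classical.choice (Coh.nonempty_of_linear s.linear t.linear))) _

theorem Y.act_self {n : ℕ} {s : Y n} (a : s ⟶ s) (x : Fin n → C) : Y.act a x = 𝟙 _ :=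
  coh_eval_unique x s.linear.1 _ (.id _)

/-- Both sides have the source tuple `concat b`, so no reordering is needed. The canonical parts go
from `μ` on `concat b` to the `κ`-composite, once through `κ` on `concat b` and once through the
`μ`-composite; naturality of the map from `μ n c` to `κ n c` then moves `g` into place. -/
theorem canonicalMap_comp (κ μ : Choice C) {n : ℕ} {j : Fin n → ℕ} {d : C} {c : Fin n → C}
    {b : ∀ s, Fin (j s) → C} (f : κ.bar c ⟶ d) (g : ∀ s, κ.bar (b s) ⟶ c s) :
    (canonicalMap κ μ).map ((U κ).comp (x := b) (y := c) (z := d) f g) =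
      (U μ).comp (x := b) (y := c) (z := d) ((canonicalMap κ μ).map (x := c) (y := d) f)
        fun s => (canonicalMap κ μ).map (x := b s) (y := c s) (g s) := by
  have hb : ∀ s k, b s k = concat b (finSigmaFinEquiv ⟨s, k⟩) := fun s k =>
    congrArg (fun p : Σ s, Fin (j s) => b p.1 p.2) (finSigmaFinEquiv.symm_apply_apply ⟨s, k⟩).symm
  have h₁ := Y.isCan_act (X := concat b) (x := concat b) leaf (fun _ => rfl)
    (default : μ _ (concat b) ⟶ κ _ (concat b))
  have h₂ := Y.isCan_gamma (X := concat b) (x := b) leaf (fun _ => rfl)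
    (default : κ _ (concat b) ⟶ (κ n c).gamma fun s => κ _ (b s))
  have h₃ := Y.isCan_gamma (X := concat b) (x := b) leaf (fun _ => rfl)
    (default : μ _ (concat b) ⟶ (μ n c).gamma fun s => μ _ (b s))
  have h₄ := IsCan.evalMap (x := concat b) (μ n c).tree fun s =>
    Y.isCan_act (X := concat b) (x := b s) (fun k => leaf (finSigmaFinEquiv ⟨s, k⟩))
      (hb s) (default : μ _ (b s) ⟶ κ _ (b s))
  have h₅ := Y.isCan_act (X := concat b) (x := fun s => κ.bar (b s))
    (fun s => (κ _ (b s)).tree.bind fun k => leaf (finSigmaFinEquiv ⟨s, k⟩))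
    (fun s => by
      rw [eval_bind]
      exact congrArg (κ _ (b s)).tree.eval (funext (hb s)))
    (default : μ n c ⟶ κ n c)
  have h := (h₁.comp h₂).unique (by rw [bind_leaf]; exact (μ _ _).linear.1) ((h₃.comp h₄).comp h₅)
  have e₁ : (canonicalMap κ μ).map ((U κ).comp (x := b) (y := c) (z := d) f g) =
      (Y.act (default : μ _ (concat b) ⟶ κ _ (concat b)) (concat b) ≫
        Y.act (default : κ _ (concat b) ⟶ (κ n c).gamma fun s => κ (j s) (b s)) (concat b) ≫
        eqToHom ((κ n c).obj_gamma _ b)) ≫ (κ n c).map g ≫ f :=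
    (congrArg (_ ≫ ·) (U_comp_eq κ f g)).trans (Category.assoc _ _ _).symm
  refine e₁.trans ((congrArg (· ≫ _) h).trans ?_)
  refine Eq.trans ?_ (U_comp_eq μ _ _).symm
  refine (Category.assoc _ _ _).trans ((Category.assoc _ _ _).trans (congrArg (_ ≫ ·) ?_))
  have h₆ := Y.map_comp (μ n c) (fun s => Y.act (default : μ _ (b s) ⟶ κ _ (b s)) (b s)) g
  refine Eq.trans ?_ (congrArg (· ≫ _) h₆.symm)
  refine Eq.trans (congrArg (_ ≫ ·) ?_) (Category.assoc _ _ _).symm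
  refine (Category.assoc _ _ _).symm.trans (Eq.trans (congrArg (· ≫ f) ?_) (Category.assoc _ _ _))
  exact Y.act_naturality _ _

theorem canonicalMap_perm (κ μ : Choice C) {n : ℕ} {d : C} {c : Fin n → C}
    (σ : Equiv.Perm (Fin n)) (f : κ.bar c ⟶ d) :
    (canonicalMap κ μ).map ((U κ).perm (x := c) (y := d) σ f) =
      (U μ).perm (x := c) (y := d) σ ((canonicalMap κ μ).map (x := c) (y := d) f) := by
  have h₁ := Y.isCan_act (X := c ∘ σ) (x := c ∘ σ) leaf (fun _ => rfl)
    (default : μ n (c ∘ σ) ⟶ κ n (c ∘ σ))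
  have h₂ := Y.isCan_perm (X := c ∘ σ) (x := c) (σ := σ) leaf (fun _ => rfl)
    (default : κ n (c ∘ σ) ⟶ (κ n c).perm σ)
  have h₃ := Y.isCan_perm (X := c ∘ σ) (x := c) (σ := σ) leaf (fun _ => rfl)
    (default : μ n (c ∘ σ) ⟶ (μ n c).perm σ)
  have h₄ := Y.isCan_act (X := c ∘ σ) (x := c) (leaf ∘ σ.symm)
    (fun i => by simp [SlotTree.eval]) (default : μ n c ⟶ κ n c)
  have h := (h₁.comp h₂).unique (by rw [bind_leaf]; exact (μ n _).linear.1) (h₃.comp h₄)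
  refine (congrArg (_ ≫ ·) (U_perm_eq κ σ f)).trans ((Category.assoc _ _ _).symm.trans ?_)
  refine (congrArg (· ≫ f) h).trans ((Category.assoc _ _ _).trans ?_)
  exact (U_perm_eq μ σ _).symm

/-- The canonical map as a map of multicategories. -/
noncomputable def canonicalFunctor (κ μ : Choice C) : Multifunctor (U κ) (U μ) where
  toMultigraphMap := canonicalMap κ μ
  map_id a := Y.act_comp (C := C) default default default (fun _ : Fin 1 => a)
  map_comp f g := canonicalMap_comp κ μ f g
  map_perm σ f := canonicalMap_perm κ μ σ f

theorem Multifunctor.toMultigraphMap_injective {M : MulticategoryData.{u, v}}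
    {N : MulticategoryData.{u', v'}} {F G : Multifunctor M N}
    (h : F.toMultigraphMap = G.toMultigraphMap) : F = G := by
  cases F
  cases G
  cases h
  rfl

theorem canonicalFunctor_comp (κ μ ρ : Choice C) :
    (canonicalFunctor κ μ).comp (canonicalFunctor μ ρ) = canonicalFunctor κ ρ := by
  refine Multifunctor.toMultigraphMap_injective
    -- The object maps agree by definition, so only the maps on multimorphisms are left to compare.
    (congrArg (@MultigraphMap.mk (U κ) (U ρ) fun a => a) ?_)
  funext n x y f
  exact (Category.assoc (obj := C) _ _ _).symm.trans
    (congrArg (fun g => CategoryStruct.comp (obj := C) g f) (Y.act_comp (C := C) _ _ _ x))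

theorem canonicalFunctor_self (κ : Choice C) :
    canonicalFunctor κ κ = Multifunctor.id (U κ) := by
  refine Multifunctor.toMultigraphMap_injective
    (congrArg (@MultigraphMap.mk (U κ) (U κ) fun a => a) ?_)
  funext n x y f
  exact (congrArg (fun g => CategoryStruct.comp (obj := C) g f) (Y.act_self (C := C) _ x)).trans
    (Category.id_comp (obj := C) _)

/-- The canonical isomorphism between the multicategories of two choices. -/
noncomputable def canonicalIso (κ μ : Choice C) : MultiIso (U κ) (U μ) where
  hom := canonicalFunctor κ μ
  inv := canonicalFunctor μ κ
  hom_inv_id := (canonicalFunctor_comp κ μ κ).trans (canonicalFunctor_self κ)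
  inv_hom_id := (canonicalFunctor_comp μ κ μ).trans (canonicalFunctor_self μ)

end SMCMulti

theorem theorem2p3 (C : Type u) [Category.{v} C] [MonoidalCategory C] [SymmetricCategory C] :
    -- each choice determines a multicategory
    (∀ κ : Choice C, (U κ).IsMulticategory) ∧
    -- the unique morphism `s ⟶ t` of `Y(n)` acts through every composite of coherence isomorphisms
    (∀ (n : ℕ) (s t : Y n) (a : s ⟶ t) (m : Coh s.tree t.tree) (x : Fin n → C),
      Y.act a x = m.eval x) ∧
    -- the canonical and coherent isomorphisms
    ∃ Φ : ∀ κ μ : Choice C, MultiIso (U κ) (U μ),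
      (∀ κ μ : Choice C, (Φ κ μ).hom.toMultigraphMap = canonicalMap κ μ) ∧
      (∀ κ μ ρ : Choice C, (Φ κ μ).hom.comp (Φ μ ρ).hom = (Φ κ ρ).hom) ∧
      (∀ κ : Choice C, (Φ κ κ).hom = Multifunctor.id (U κ)) := by
  exact ⟨isMulticategory_U, fun n s t a m x => Y.act_eq a m x, canonicalIso, fun _ _ => rfl,
    canonicalFunctor_comp, canonicalFunctor_self⟩
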